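/- Let $1<\beta<2$ and $a>0$. Write $\lambda_p=p^2$ and $\phi_p(y)=\sqrt{2/\pi}\,\sin(py)$, $p=1,2,\dots$, for the Dirichlet eigenvalues and eigenfunctions of $-\Delta$ on $(0,\pi)$, and let $E_{\beta,\gamma}(z)=\sum_{k\ge0}z^k/\Gamma(\beta k+\gamma)$. There is a constant $C_3>0$ with $$t^{\beta-1}E_{\beta,\beta}(\lambda_pt^\beta)\le C_3\exp(\lambda_p^{1/\beta}t)\qquad(t\in[0,a],\ p\ge1);$$ fix any such constant and put $$\overline G(t,v)=\sum_{p=1}^\infty\frac{\exp(\lambda_p^{1/\beta}(t-a))}{2aC_3}\langle v,\phi_p\rangle\phi_p,\qquad v\in L^2(0,\pi).$$ Consider the Cauchy problem for the fractional elliptic equation $$\frac{D^\beta u}{Dt^\beta}=-\Delta u+\overline G(t,u)\ \text{ on }(0,a)\times(0,\pi),\quad u(t,0)=u(t,\pi)=0,\quad u(0,\cdot)=u_0,\quad u_t(0,\cdot)=u_1,$$ where $\frac{D^\beta u}{Dt^\beta}(t)=\frac1{\Gamma(2-\beta)}\int_0^t(t-\eta)^{1-\beta}u''(\eta)\,d\eta$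 is the Caputo derivative in $t$. A mild solution is a function $u\in C([0,a];L^2(0,\pi))$ such that for all $t\in[0,a]$ $$u(t)=\sum_{p=1}^\infty\Big[E_{\beta,1}(\lambda_pt^\beta)\langle u_0,\phi_p\rangle+tE_{\beta,2}(\lambda_pt^\beta)\langle u_1,\phi_p\rangle+\int_0^t(t-\eta)^{\beta-1}E_{\beta,\beta}(\lambda_p(t-\eta)^\beta)\langle\overline G(\eta,u(\eta)),\phi_p\rangle\,d\eta\Big]\phi_p.$$ A strong solution is a function $u\in C^1([0,a];L^2(0,\pi))$ that is twice differentiable on $(0,a)$, with $u''$ and, for $t\in(0,a)$, $\eta\mapsto(t-\eta)^{1-\beta}u''(\eta)$ integrable on $(0,a)$ and $(0,t)$ respectively, with $u(t)\in H^2(0,\pi)\cap H^1_0(0,\pi)$ for $t\in(0,a)$, and that satisfies the equation for all $t\in(0,a)$ and the initial conditions. Then, for mild solutions as well as for strong solutions, the problem is ill-posed in the sense of Hadamard: there are $u_0,u_1\in L^2(0,\pi)$ for which it has no solution, and solutions, where they exist, do not depend continuously, in $C([0,a];L^2(0,\pi))$, on $(u_0,u_1)\in L^2(0,\pi)^2$.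 This instability occurs under random noise. Let $\xi$ be a Gaussian white noise on $L^2(0,\pi)$ (so that the $\langle\xi,\phi_p\rangle$ are independent $N(0,1)$ variables), and for $0<\varepsilon<1$ let $$N(\varepsilon)=\Big\lfloor\Big(\tfrac2a\ln\tfrac1\varepsilon\Big)^{\beta/2}\Big\rfloor+1,\qquad U_{N(\varepsilon)}=\sum_{p=1}^{N(\varepsilon)}\varepsilon\langle\xi,\phi_p\rangle\phi_p .$$ Then $\mathbf E\|U_{N(\varepsilon)}\|_{L^2(0,\pi)}^2=\varepsilon^2N(\varepsilon)$, which tends to $0$ as $\varepsilon\to0^+$. For every $\varepsilon\in(0,1)$ and every realization of the noise, the problem with data $u_0=U_{N(\varepsilon)}$, $u_1=0$ has exactly one mild solution and exactly one strong solution, and they are the same function $V_{N(\varepsilon)}\in C([0,a];L^2(0,\pi))$. The random variable $V_{N(\varepsilon)}$ is square integrable, and $$\mathbf E\|V_{N(\varepsilon)}\|_{C([0,a];L^2(0,\pi))}^2\ \ge\ \frac{c}{\varepsilon^2}\ \longrightarrow\ \infty\qquad(\varepsilon\to0^+),$$ where $c>0$ depends only on $\beta$. -/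

import Mathlib

open MeasureTheory ProbabilityTheory Filter Topology

noncomputable section

namespace FracElliptic

/-- The real Hilbert space `L²(0, π)`. -/
abbrev L2 : Type := Lp ℝ 2 (volume.restrict (Set.Ioo (0 : ℝ) Real.pi))

/-- The Banach space `C([0, a]; L²(0, π))` with the supremum norm. -/
abbrev CL2 (a : ℝ) : Type := C(Set.Icc (0 : ℝ) a, L2)

/-- The Dirichlet eigenvalues `λ_p = p²`, `p = 1, 2, …`, of `-Δ` on `(0, π)`. -/
def eigenvalue (p : ℕ+) : ℝ := ((p : ℕ) : ℝ) ^ 2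

theorem memLp_eigenfun (p : ℕ+) :
    MemLp (fun y : ℝ => √(2 / Real.pi) * Real.sin (((p : ℕ) : ℝ) * y)) 2
      (volume.restrict (Set.Ioo (0 : ℝ) Real.pi)) := by
  refine MemLp.of_bound (by fun_prop) (√(2 / Real.pi)) (Eventually.of_forall fun y => ?_)
  rw [norm_mul, Real.norm_of_nonneg (Real.sqrt_nonneg _)]
  exact mul_le_of_le_one_right (Real.sqrt_nonneg _) (by
    rw [Real.norm_eq_abs]; exact Real.abs_sin_le_one _)

/-- The Dirichlet eigenfunctions `φ_p(y) = √(2/π) sin (p y)` as elements of `L²(0, π)`. -/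
def eigenfun (p : ℕ+) : L2 := (memLp_eigenfun p).toLp _

/-- The Mittag-Leffler function `E_{β,γ}(z) = ∑_{k ≥ 0} z^k / Γ(β k + γ)`. -/
def mittagLeffler (β γ z : ℝ) : ℝ := ∑' k : ℕ, z ^ k / Real.Gamma (β * k + γ)

/-- `v` lies in the domain `H²(0, π) ∩ H¹₀(0, π)` of the Dirichlet Laplacian and `-Δ v = w`:
`v` has a representative `f` on `[0, π]` which is continuously differentiable, vanishes at both end
points, and whose derivative `g` is absolutely continuous with `g' = -w` almost everywhere. -/
def IsNegLaplacian (v w : L2) : Prop :=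
  ∃ f g : ℝ → ℝ,
    (∀ᵐ y ∂(volume.restrict (Set.Ioo (0 : ℝ) Real.pi)), v y = f y) ∧
    f 0 = 0 ∧ f Real.pi = 0 ∧
    (∀ y ∈ Set.Icc (0 : ℝ) Real.pi,
      HasDerivWithinAt f (g y) (Set.Icc (0 : ℝ) Real.pi) y) ∧
    ∀ y ∈ Set.Icc (0 : ℝ) Real.pi, g y = g 0 - ∫ z in (0 : ℝ)..y, w z

/-- The Caputo derivative of order `β ∈ (1, 2)`,
`(1 / Γ(2 - β)) ∫₀ᵗ (t - η)^{1 - β} U''(η) dη`. -/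
def caputoDeriv (β : ℝ) (U : ℝ → L2) (t : ℝ) : L2 :=
  (1 / Real.Gamma (2 - β)) • ∫ η in (0 : ℝ)..t, (t - η) ^ (1 - β) • deriv (deriv U) η

/-- `u ∈ C([0, a]; L²(0, π))` is a strong solution of the Cauchy problem
`D^β u / Dt^β = -Δ u + G(t, u)` on `(0, a) × (0, π)`, with `u = 0` at `y = 0, π`,
`u(0) = u₀` and `u_t(0) = u₁`.
The function `u` is once continuously differentiable on `[0, a]`, twice differentiable on `(0, a)`,
and its second derivative is integrable, so that the Caputo derivative makes sense. Only the values
of `Set.IccExtend ha.le u` on `[0, a]`, where it is `u`, matter. -/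
structure IsStrongSolution {a : ℝ} (β : ℝ) (ha : 0 < a) (G : ℝ → L2 → L2) (u₀ u₁ : L2)
    (u : CL2 a) : Prop where
  contDiffOn : ContDiffOn ℝ 1 (Set.IccExtend ha.le u) (Set.Icc 0 a)
  differentiableAt_deriv :
    ∀ t ∈ Set.Ioo 0 a, DifferentiableAt ℝ (deriv (Set.IccExtend ha.le u)) t
  integrable_deriv2 :
    IntervalIntegrable (deriv (deriv (Set.IccExtend ha.le u))) volume 0 a
  initial : Set.IccExtend ha.le u 0 = u₀
  initial_velocity : HasDerivWithinAt (Set.IccExtend ha.le u) u₁ (Set.Icc 0 a) 0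
  integrable_caputo : ∀ t ∈ Set.Ioo 0 a,
    IntervalIntegrable
      (fun η => (t - η) ^ (1 - β) • deriv (deriv (Set.IccExtend ha.le u)) η) volume 0 t
  equation : ∀ t ∈ Set.Ioo 0 a, ∃ w : L2,
    IsNegLaplacian (Set.IccExtend ha.le u t) w ∧
    caputoDeriv β (Set.IccExtend ha.le u) t = w + G t (Set.IccExtend ha.le u t)

/-- The `p`-th Fourier coefficient on the right-hand side of the mild formulation. -/
def mildCoeff (β : ℝ) (G : ℝ → L2 → L2) (u₀ u₁ : L2) (U : ℝ → L2) (t : ℝ) (p : ℕ+) : ℝ :=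
  mittagLeffler β 1 (eigenvalue p * t ^ β) * inner ℝ u₀ (eigenfun p)
    + t * mittagLeffler β 2 (eigenvalue p * t ^ β) * inner ℝ u₁ (eigenfun p)
    + ∫ η in (0 : ℝ)..t, (t - η) ^ (β - 1) *
        mittagLeffler β β (eigenvalue p * (t - η) ^ β) * inner ℝ (G η (U η)) (eigenfun p)

/-- `u ∈ C([0, a]; L²(0, π))` is a mild solution of the same Cauchy problem: it is given by the
Fourier series with coefficients `mildCoeff`, convergent in `L²(0, π)` for every `t ∈ [0, a]`. -/
structure IsMildSolution {a : ℝ} (β : ℝ) (ha : 0 < a) (G : ℝ → L2 → L2) (u₀ u₁ : L2)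
    (u : CL2 a) : Prop where
  integrable : ∀ t ∈ Set.Icc 0 a, ∀ p : ℕ+, IntervalIntegrable
    (fun η => (t - η) ^ (β - 1) * mittagLeffler β β (eigenvalue p * (t - η) ^ β) *
      inner ℝ (G η (Set.IccExtend ha.le u η)) (eigenfun p)) volume 0 t
  hasSum : ∀ t ∈ Set.Icc 0 a,
    HasSum (fun p : ℕ+ => mildCoeff β G u₀ u₁ (Set.IccExtend ha.le u) t p • eigenfun p)
      (Set.IccExtend ha.le u t)

/-- A Cauchy problem with solution relation `Sol u₀ u₁ u` is ill-posed in the sense of Hadamard: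
a solution does not always exist, and solutions that exist do not depend continuously on the
data. -/
def HadamardIllPosed {a : ℝ} (Sol : L2 → L2 → CL2 a → Prop) : Prop :=
  (∃ u₀ u₁ : L2, ∀ u : CL2 a, ¬ Sol u₀ u₁ u) ∧
  ∃ (u₀ u₁ : L2) (u : CL2 a) (d₀ d₁ : ℕ → L2) (v : ℕ → CL2 a),
    Sol u₀ u₁ u ∧ (∀ n, Sol (d₀ n) (d₁ n) (v n)) ∧
    Tendsto d₀ atTop (𝓝 u₀) ∧ Tendsto d₁ atTop (𝓝 u₁) ∧ ¬ Tendsto v atTop (𝓝 u)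

/-- `C₃` is an admissible constant in the bound
`t^{β-1} E_{β,β}(λ_p t^β) ≤ C₃ exp(λ_p^{1/β} t)`, `t ∈ [0, a]`, `p ≥ 1`. -/
def IsKernelBound (β a C₃ : ℝ) : Prop :=
  0 < C₃ ∧ ∀ t ∈ Set.Icc 0 a, ∀ p : ℕ+,
    t ^ (β - 1) * mittagLeffler β β (eigenvalue p * t ^ β) ≤
      C₃ * Real.exp (eigenvalue p ^ (1 / β) * t)

/-- The source term
`Ḡ(t, v) = ∑_p exp(λ_p^{1/β} (t - a)) / (2 a C₃) ⟨v, φ_p⟩ φ_p`. -/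
def sourceG (β a C₃ : ℝ) (t : ℝ) (v : L2) : L2 :=
  ∑' p : ℕ+, (Real.exp (eigenvalue p ^ (1 / β) * (t - a)) / (2 * a * C₃) *
    inner ℝ v (eigenfun p)) • eigenfun p

/-- `ξ` is a Gaussian white noise on `L²(0, π)` (an isonormal Gaussian process): the real random
variable `ξ f`, which stands for `⟨ξ, f⟩`, is linear in `f` almost surely and has the law
`N(0, ‖f‖²)`. In particular the `⟨ξ, φ_p⟩` are independent standard Gaussian variables. -/
structure IsWhiteNoise {Ω : Type*} [MeasurableSpace Ω] (P : Measure Ω) (ξ : L2 → Ω → ℝ) :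
    Prop where
  linear : ∀ (c : ℝ) (f g : L2), ∀ᵐ ω ∂P, ξ (c • f + g) ω = c * ξ f ω + ξ g ω
  law : ∀ f : L2, HasLaw (ξ f) (gaussianReal 0 (‖f‖₊ ^ 2)) P

/-- The truncation level `N(ε) = ⌊((2/a) ln(1/ε))^{β/2}⌋ + 1`. -/
def truncLevel (β a ε : ℝ) : ℕ+ :=
  Nat.succPNat ⌊(2 / a * Real.log (1 / ε)) ^ (β / 2)⌋₊

/-- The truncated noisy data `U_{N(ε)} = ∑_{p ≤ N(ε)} ε ⟨ξ, φ_p⟩ φ_p`. -/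
def noisyData {Ω : Type*} (ξ : L2 → Ω → ℝ) (β a ε : ℝ) (ω : Ω) : L2 :=
  ∑ p ∈ Finset.Icc 1 (truncLevel β a ε), (ε * ξ (eigenfun p) ω) • eigenfun p

end FracElliptic

end

/-!
Expanding in the sine basis `φ_p` decouples the Cauchy problem into scalar equations: the `p`-th
Fourier coefficient `y` of a mild solution with `u₁ = 0` satisfies the Volterra equation
`y(t) = c E_{β,1}(λ_p t^β) + ∫₀ᵗ k_p(t - s) g_p(s) y(s) ds` with
`k_p(s) = s^(β-1) E_{β,β}(λ_p s^β)` and `g_p` the weight of the source term. The kernel bound gives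
`0 ≤ k_p(t - s) g_p(s) ≤ 1 / (2a)`, so the Volterra operator is a positive contraction with
constant `1 / 2`. Hence every mode has exactly one solution, and for `c ≥ 0` the solution
dominates its free term, so at time `a` it is at least `c E_{β,1}(λ_p a^β)`
(`IsHalfKernel.exists_solution`, `IsHalfKernel.unique`, `IsHalfKernel.free_term_le`).

The function `E_{β,1}(s^β)` is bounded below by a multiple of `exp s`
(`exp_le_mittagLeffler_one`), the constant being independent of everything else. So the mode `p`
is amplified by at least a multiple of `exp(λ_p^{1/β} a)`. Data with coefficients `1 / p` therefore
admit no solution, and the data `φ_p / p → 0` have solutions whose norms tend to infinity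
(`hadamardIllPosed`). For the noisy data the truncation level is such that the last mode is
amplified by at least a multiple of `ε⁻²`, which gives the lower bound `c / ε²` for the second
moment (`le_integral_norm_sq`).

Strong solutions are related to mild ones through Riemann–Liouville fractional integrals `I^α`. By
their semigroup property (`fracInt_fracInt`), the scalar Caputo equation `D^β y = q y`,
`y(0) = c`, `y'(0) = 0` is equivalent to `y = c + I^β(q y)`: one direction is integration
(`eq_fracInt_of_caputo`), the other is a regularity argument (`exists_deriv_of_eq_fracInt`). The
latter equation is in turn equivalent to its Mittag-Leffler form by the resolvent identity of
`I^β` (`eq_mittagLeffler_iff`). So every strong solution is mild, and the mild solution is strong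
when the data have finitely many modes.
-/

noncomputable section

namespace FracElliptic

/-! ### Gamma function estimates and exponential bounds for Mittag-Leffler functions -/

/-- The Riemann–Liouville kernel `s ^ (α - 1) / Γ(α)`, whose convolution powers obey
`rlKernel α ∗ rlKernel γ = rlKernel (α + γ)`. -/
def rlKernel (α s : ℝ) : ℝ := s ^ (α - 1) / Real.Gamma α

theorem rlKernel_nonneg {α s : ℝ} (hα : 0 < α) (hs : 0 ≤ s) : 0 ≤ rlKernel α s :=
  div_nonneg (Real.rpow_nonneg hs _) (Real.Gamma_pos_of_pos hα).le

theorem rlKernel_pos {α s : ℝ} (hα : 0 < α) (hs : 0 < s) : 0 < rlKernel α s :=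
  div_pos (Real.rpow_pos_of_pos hs _) (Real.Gamma_pos_of_pos hα)

theorem rlKernel_natCast_add_one (n : ℕ) (s : ℝ) :
    rlKernel (n + 1) s = s ^ n / (n.factorial : ℝ) := by
  rw [rlKernel, Real.Gamma_nat_eq_factorial, add_sub_cancel_right, Real.rpow_natCast]

theorem log_Gamma_add_one {y : ℝ} (hy : 0 < y) :
    Real.log (Real.Gamma (y + 1)) = Real.log y + Real.log (Real.Gamma y) := by
  rw [Real.Gamma_add_one hy.ne', Real.log_mul hy.ne' (Real.Gamma_pos_of_pos hy).ne']

/-- The slope of the convex function `log Γ` on `[y, y + δ]` is at most its slope `log (y + δ)` on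
the unit interval to the right. -/
theorem log_Gamma_add_le {y δ : ℝ} (hy : 0 < y) (hδ : 0 ≤ δ) :
    Real.log (Real.Gamma (y + δ)) ≤ Real.log (Real.Gamma y) + δ * Real.log (y + δ) := by
  rcases hδ.eq_or_lt with rfl | hδ
  · simp
  have h := Real.convexOn_log_Gamma.slope_mono_adjacent (x := y) (y := y + δ) (z := y + δ + 1)
    (Set.mem_Ioi.2 hy) (Set.mem_Ioi.2 (by linarith)) (by linarith) (by linarith)
  simp only [Function.comp_apply] at h
  rw [log_Gamma_add_one (by linarith : 0 < y + δ), add_sub_cancel_left, add_sub_cancel_left,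
    div_one, div_le_iff₀ hδ] at h
  linarith

/-- A lower bound for the slope of `log Γ` on `[y, y + δ]` that stays useful at `y = 1`. The
slope on `[y + 1, y + 1 + δ]` is at least `log y`, and the functional equation shifts back by
one. -/
theorem le_log_Gamma_add {y δ : ℝ} (hy : 0 < y) (hδ : 0 ≤ δ) :
    Real.log (Real.Gamma y) + δ * Real.log y + Real.log y - Real.log (y + δ) ≤
      Real.log (Real.Gamma (y + δ)) := by
  rcases hδ.eq_or_lt with rfl | hδ
  · simp
  have h := Real.convexOn_log_Gamma.slope_mono_adjacent (x := y) (y := y + 1) (z := y + δ + 1)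
    (Set.mem_Ioi.2 hy) (Set.mem_Ioi.2 (by linarith)) (by linarith) (by linarith)
  simp only [Function.comp_apply] at h
  rw [log_Gamma_add_one (by linarith : 0 < y + δ), log_Gamma_add_one hy, add_sub_cancel_left,
    div_one, (by ring : y + δ + 1 - (y + 1) = δ), le_div_iff₀ hδ] at h
  linarith

/-- For fixed `s`, the function `γ ↦ rlKernel γ s` is log-concave up to bounded factors, so its
value at an intermediate point is dominated by the values at the two ends. -/
theorem rlKernel_le_add {y δ l s : ℝ} (hy : 1 ≤ y) (hδ : 0 ≤ δ) (hδl : δ ≤ l) (hl : l ≤ 2)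
    (hs : 0 < s) : rlKernel (y + δ) s ≤ 27 * (rlKernel y s + rlKernel (y + l) s) := by
  have hy0 : 0 < y := by linarith
  have hlog : ∀ α : ℝ, 0 < α → Real.log (rlKernel α s) =
      (α - 1) * Real.log s - Real.log (Real.Gamma α) := fun α hα => by
    rw [rlKernel, Real.log_div (Real.rpow_pos_of_pos hs _).ne' (Real.Gamma_pos_of_pos hα).ne',
      Real.log_rpow hs]
  have h3 : 0 < Real.log 3 := Real.log_pos (by norm_num)
  have hle : ∀ d : ℝ, 0 ≤ d → d ≤ 2 → Real.log (y + d) ≤ Real.log y + Real.log 3 := by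
    intro d h0 h2
    rw [← Real.log_mul hy0.ne' (by norm_num)]
    exact Real.log_le_log (by linarith) (by linarith)
  have h1 := le_log_Gamma_add hy0 hδ
  have h2 := log_Gamma_add_le hy0 (hδ.trans hδl)
  have hp0 := rlKernel_pos (show 0 < y by linarith) hs
  have hp1 := rlKernel_pos (show 0 < y + δ by linarith) hs
  have hp2 := rlKernel_pos (show 0 < y + l by linarith) hs
  have e0 := hlog y hy0
  have e1 := hlog (y + δ) (by linarith)
  have e2 := hlog (y + l) (by linarith)
  have hd1 := hle δ hδ (by linarith)
  have hd2 := hle l (by linarith) hl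
  -- the logarithm of the kernel has slope about `log s - log y` between `y` and `y + l`, so the
  -- left end dominates for `s ≤ y` and the right end otherwise
  rcases le_total (Real.log s) (Real.log y) with h | h
  · have : Real.log (rlKernel (y + δ) s) ≤ Real.log (3 * rlKernel y s) := by
      rw [Real.log_mul (by norm_num) hp0.ne', e0, e1]
      nlinarith [mul_le_mul_of_nonneg_left h hδ]
    have := (Real.log_le_log_iff hp1 (by positivity)).1 this
    linarith
  · have : Real.log (rlKernel (y + δ) s) ≤ Real.log (3 ^ 3 * rlKernel (y + l) s) := by
      rw [Real.log_mul (by norm_num) hp2.ne', Real.log_pow, e2, e1]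
      have a1 : l * Real.log (y + l) ≤ l * (Real.log y + Real.log 3) :=
        mul_le_mul_of_nonneg_left hd2 (by linarith)
      have a2 : δ * (Real.log s - Real.log y) ≤ l * (Real.log s - Real.log y) :=
        mul_le_mul_of_nonneg_right hδl (by linarith)
      have a3 : l * Real.log 3 ≤ 2 * Real.log 3 := mul_le_mul_of_nonneg_right hl h3.le
      push_cast
      nlinarith
    have := (Real.log_le_log_iff hp1 (by positivity)).1 this
    linarith

theorem one_div_Gamma_le {β γ : ℝ} (hβ : 1 ≤ β) (hγ : 1 ≤ γ) (k : ℕ) :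
    1 / Real.Gamma (β * k + γ) ≤ (1 / Real.Gamma γ + 1) * (1 / (k.factorial : ℝ)) := by
  have hg : 0 < Real.Gamma γ := Real.Gamma_pos_of_pos (by linarith)
  rcases Nat.eq_zero_or_pos k with rfl | hk
  · simp
  have hk1 : (1 : ℝ) ≤ k := by exact_mod_cast hk
  have h : (k.factorial : ℝ) ≤ Real.Gamma (β * k + γ) := by
    rw [← Real.Gamma_nat_eq_factorial]
    apply Real.Gamma_strictMonoOn_Ici.monotoneOn (Set.mem_Ici.2 (by linarith))
      (Set.mem_Ici.2 (by nlinarith)) (by nlinarith)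
  have hf : (0 : ℝ) < k.factorial := by positivity
  calc 1 / Real.Gamma (β * k + γ) ≤ 1 * (1 / (k.factorial : ℝ)) := by
        rw [one_mul]; exact one_div_le_one_div_of_le hf h
    _ ≤ _ := by
        apply mul_le_mul_of_nonneg_right _ (by positivity)
        have : 0 ≤ 1 / Real.Gamma γ := by positivity
        linarith

theorem norm_mittagLeffler_term_le {β γ : ℝ} (hβ : 1 ≤ β) (hγ : 1 ≤ γ) {z R : ℝ} (hz : |z| ≤ R)
    (k : ℕ) : ‖z ^ k / Real.Gamma (β * k + γ)‖ ≤
      (1 / Real.Gamma γ + 1) * (R ^ k / (k.factorial : ℝ)) := by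
  have hG : 0 < Real.Gamma (β * k + γ) := Real.Gamma_pos_of_pos (by positivity)
  have hR : 0 ≤ R := (abs_nonneg z).trans hz
  rw [norm_div, norm_pow, Real.norm_eq_abs, Real.norm_of_nonneg hG.le, div_eq_mul_one_div]
  calc |z| ^ k * (1 / Real.Gamma (β * k + γ))
      ≤ R ^ k * ((1 / Real.Gamma γ + 1) * (1 / (k.factorial : ℝ))) :=
        mul_le_mul (pow_le_pow_left₀ (abs_nonneg z) hz k) (one_div_Gamma_le hβ hγ k)
          (by positivity) (by positivity)
    _ = _ := by ring

theorem summable_mittagLeffler {β γ : ℝ} (hβ : 1 ≤ β) (hγ : 1 ≤ γ) (z : ℝ) :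
    Summable fun k : ℕ => z ^ k / Real.Gamma (β * k + γ) :=
  Summable.of_norm_bounded ((Real.summable_pow_div_factorial |z|).mul_left _)
    (norm_mittagLeffler_term_le hβ hγ le_rfl)

theorem continuous_mittagLeffler {β γ : ℝ} (hβ : 1 ≤ β) (hγ : 1 ≤ γ) :
    Continuous (mittagLeffler β γ) := by
  refine continuous_iff_continuousAt.2 fun z => ?_
  have hc : ContinuousOn (mittagLeffler β γ) (Metric.ball 0 (|z| + 1)) := by
    refine continuousOn_tsum (fun k => by fun_prop)
      ((Real.summable_pow_div_factorial (|z| + 1)).mul_left (1 / Real.Gamma γ + 1)) fun k x hx => ?_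
    refine norm_mittagLeffler_term_le hβ hγ ?_ k
    simpa [Real.norm_eq_abs] using (mem_ball_zero_iff.1 hx).le
  exact hc.continuousAt (Metric.isOpen_ball.mem_nhds (by simp))

theorem mittagLeffler_nonneg {β γ z : ℝ} (hβ : 1 ≤ β) (hγ : 1 ≤ γ) (hz : 0 ≤ z) :
    0 ≤ mittagLeffler β γ z :=
  tsum_nonneg fun k => div_nonneg (pow_nonneg hz k) (Real.Gamma_pos_of_pos (by positivity)).le

/-- The series of `s ^ (γ - 1) E_{β,γ}(μ s ^ β)` in terms of Riemann–Liouville kernels. -/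
theorem hasSum_rlKernel {β γ : ℝ} (hβ : 1 ≤ β) (hγ : 1 ≤ γ) (μ : ℝ) {s : ℝ} (hs : 0 ≤ s) :
    HasSum (fun k : ℕ => μ ^ k * rlKernel (β * k + γ) s)
      (s ^ (γ - 1) * mittagLeffler β γ (μ * s ^ β)) := by
  have h := ((summable_mittagLeffler hβ hγ (μ * s ^ β)).hasSum).mul_left (s ^ (γ - 1))
  refine h.congr_fun ?_
  intro k
  rw [rlKernel, mul_pow, ← Real.rpow_natCast, ← Real.rpow_natCast, ← Real.rpow_mul hs,
    add_sub_assoc, Real.rpow_add_of_nonneg hs (by positivity) (by linarith)]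
  ring

theorem floor_lt_floor_of_add_one_le {x y : ℝ} (hx : 0 ≤ x) (h : x + 1 ≤ y) : ⌊x⌋₊ < ⌊y⌋₊ := by
  have : ⌊x⌋₊ + 1 ≤ ⌊y⌋₊ := by
    rw [← Nat.floor_add_one hx]; exact Nat.floor_mono h
  omega

theorem hasSum_pow_div_factorial (s : ℝ) :
    HasSum (fun n : ℕ => s ^ n / (n.factorial : ℝ)) (Real.exp s) := by
  rw [Real.exp_eq_exp_ℝ]
  exact NormedSpace.expSeries_div_hasSum_exp s

/-- The exponents `β k + β - 1` of the Mittag-Leffler series lie between the integers `n` and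
`n + 1` for distinct `n`, so each term is dominated by the two neighbouring terms of the
exponential series. -/
theorem rpow_mul_mittagLeffler_self_le {β : ℝ} (hβ : 1 < β) {s : ℝ} (hs : 0 < s) :
    s ^ (β - 1) * mittagLeffler β β (s ^ β) ≤ 54 * Real.exp s := by
  have h := hasSum_rlKernel hβ.le hβ.le 1 hs.le
  simp only [one_pow, one_mul] at h
  set n : ℕ → ℕ := fun k => ⌊β * k + (β - 1)⌋₊ with hn
  have hpos : ∀ k : ℕ, 0 ≤ β * k + (β - 1) := fun k => by
    have : 0 ≤ β * k := by positivity
    linarith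
  have hinj : Function.Injective n := (strictMono_nat_of_lt_succ fun k =>
    floor_lt_floor_of_add_one_le (hpos k) (by push_cast; nlinarith)).injective
  have hE := hasSum_pow_div_factorial s
  have hterm : ∀ k : ℕ, rlKernel (β * k + β) s ≤
      27 * (s ^ n k / ((n k).factorial : ℝ) + s ^ (n k + 1) / ((n k + 1).factorial : ℝ)) := by
    intro k
    have h1 := Nat.floor_le (hpos k)
    have h2 := Nat.lt_floor_add_one (β * k + (β - 1))
    have := rlKernel_le_add (y := n k + 1) (δ := β * k + β - (n k + 1)) (l := 1) (s := s)
      (by simp) (by simp only [hn]; linarith) (by simp only [hn]; linarith) (by norm_num) hs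
    rw [add_sub_cancel, rlKernel_natCast_add_one] at this
    have h3 := rlKernel_natCast_add_one (n k + 1) s
    push_cast at h3 ⊢
    rwa [h3] at this
  have hS : Summable fun m : ℕ => s ^ m / (m.factorial : ℝ) := hE.summable
  have hS1 : Summable fun m : ℕ => s ^ (m + 1) / ((m + 1).factorial : ℝ) :=
    (summable_nat_add_iff 1).2 hS
  have b1 : ∑' k, s ^ n k / ((n k).factorial : ℝ) ≤ Real.exp s := by
    rw [← hE.tsum_eq]
    exact Summable.tsum_le_tsum_of_inj n hinj (fun _ _ => by positivity) (fun _ => le_rfl)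
      (hS.comp_injective hinj) hS
  have b2 : ∑' k, s ^ (n k + 1) / ((n k + 1).factorial : ℝ) ≤ Real.exp s := by
    rw [← hE.tsum_eq]
    exact Summable.tsum_le_tsum_of_inj (fun k => n k + 1)
      (fun a b hab => hinj (Nat.succ_injective hab)) (fun _ _ => by positivity) (fun _ => le_rfl)
      (hS1.comp_injective hinj) hS
  have hS' := ((hS.comp_injective hinj).add (hS1.comp_injective hinj)).mul_left 27
  calc _ = ∑' k : ℕ, rlKernel (β * k + β) s := h.tsum_eq.symm
    _ ≤ _ := h.summable.tsum_le_tsum hterm hS'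
    _ ≤ _ := by
      rw [tsum_mul_left]
      have := ((hS.comp_injective hinj).tsum_add (hS1.comp_injective hinj))
      simp only [Function.comp_apply] at this ⊢
      rw [this]
      linarith

/-- The even integers lie between `β k` and `β (k + 1)` for distinct `k`, since `β ≤ 2`; so the
series of `cosh s` is dominated by a multiple of the Mittag-Leffler series. -/
theorem exp_le_mittagLeffler_one {β : ℝ} (hβ : 1 < β) (hβ2 : β < 2) {s : ℝ} (hs : 0 < s) :
    1 / 108 * Real.exp s ≤ mittagLeffler β 1 (s ^ β) := by
  have h := hasSum_rlKernel hβ.le le_rfl 1 hs.le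
  simp only [one_pow, one_mul, sub_self, Real.rpow_zero] at h
  set k : ℕ → ℕ := fun m => ⌊2 * m / β⌋₊ with hk
  have hpos : ∀ m : ℕ, 0 ≤ 2 * m / β := fun m => by positivity
  have hinj : Function.Injective k := (strictMono_nat_of_lt_succ fun m =>
    floor_lt_floor_of_add_one_le (hpos m) (by
      have : 1 ≤ 2 / β := by rw [le_div_iff₀ (by linarith)]; linarith
      push_cast
      rw [mul_add, add_div]; linarith)).injective
  have hcosh := Real.hasSum_cosh s
  have hterm : ∀ m : ℕ, s ^ (2 * m) / ((2 * m).factorial : ℝ) ≤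
      27 * (rlKernel (β * k m + 1) s + rlKernel (β * (k m + 1 : ℕ) + 1) s) := by
    intro m
    have h1 := Nat.floor_le (hpos m)
    have h2 := Nat.lt_floor_add_one (2 * m / β)
    rw [le_div_iff₀ (by linarith)] at h1
    rw [div_lt_iff₀ (by linarith)] at h2
    have hb : 0 ≤ β * k m := by positivity
    have := rlKernel_le_add (y := β * k m + 1) (δ := 2 * m - β * k m) (l := β) (s := s)
      (by linarith) (by simp only [hk]; linarith) (by simp only [hk]; linarith) hβ2.le hs
    have e := rlKernel_natCast_add_one (2 * m) s
    push_cast at e ⊢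
    rw [← e]
    convert this using 2
    · ring
    · congr 2; ring
  have hS := h.summable
  have hS1 : Summable fun j : ℕ => rlKernel (β * (j + 1 : ℕ) + 1) s :=
    (summable_nat_add_iff (f := fun j : ℕ => rlKernel (β * j + 1) s) 1).2 hS
  have hnn : ∀ j : ℕ, 0 ≤ rlKernel (β * j + 1) s := fun j => rlKernel_nonneg (by positivity) hs.le
  have b1 : ∑' m, rlKernel (β * k m + 1) s ≤ mittagLeffler β 1 (s ^ β) := by
    rw [← h.tsum_eq]
    exact Summable.tsum_le_tsum_of_inj k hinj (fun j _ => hnn j) (fun _ => le_rfl)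
      (hS.comp_injective hinj) hS
  have b2 : ∑' m, rlKernel (β * (k m + 1 : ℕ) + 1) s ≤ mittagLeffler β 1 (s ^ β) := by
    rw [← h.tsum_eq]
    exact Summable.tsum_le_tsum_of_inj (fun m => k m + 1)
      (fun a b hab => hinj (Nat.succ_injective hab)) (fun j _ => hnn j) (fun _ => le_rfl)
      (hS1.comp_injective hinj) hS
  have hS' := ((hS.comp_injective hinj).add (hS1.comp_injective hinj)).mul_left 27
  have hc : Real.cosh s ≤ 54 * mittagLeffler β 1 (s ^ β) := by
    calc Real.cosh s = ∑' m : ℕ, s ^ (2 * m) / ((2 * m).factorial : ℝ) := hcosh.tsum_eq.symm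
      _ ≤ _ := hcosh.summable.tsum_le_tsum hterm hS'
      _ ≤ _ := by
        rw [tsum_mul_left]
        have := ((hS.comp_injective hinj).tsum_add (hS1.comp_injective hinj))
        simp only [Function.comp_apply] at this ⊢
        rw [this]
        linarith
  have hexp : Real.exp s ≤ 2 * Real.cosh s := by
    rw [Real.cosh_eq]; linarith [Real.exp_pos (-s)]
  linarith

/-! ### Riemann–Liouville fractional integrals -/

/-- The Riemann–Liouville integral `∫₀ᵗ (t - s) ^ (α - 1) / Γ(α) h(s) ds` of order `α > 0`. -/
def fracInt (α : ℝ) (h : ℝ → ℝ) (t : ℝ) : ℝ := ∫ s in (0 : ℝ)..t, rlKernel α (t - s) * h s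

theorem measurable_rlKernel (α : ℝ) : Measurable (rlKernel α) := by
  unfold rlKernel; fun_prop

theorem rlKernel_one (s : ℝ) : rlKernel 1 s = 1 := by simp [rlKernel]

theorem rlKernel_le_rlKernel {α s t : ℝ} (hα : 1 ≤ α) (hs : 0 ≤ s) (hst : s ≤ t) :
    rlKernel α s ≤ rlKernel α t :=
  div_le_div_of_nonneg_right (Real.rpow_le_rpow hs hst (by linarith))
    (Real.Gamma_pos_of_pos (by linarith)).le

theorem intervalIntegrable_rlKernel {α : ℝ} (hα : 0 < α) (t : ℝ) :
    IntervalIntegrable (rlKernel α) volume 0 t :=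
  (intervalIntegral.intervalIntegrable_rpow' (by linarith)).div_const _

theorem intervalIntegrable_rlKernel_sub {α : ℝ} (hα : 0 < α) (t : ℝ) :
    IntervalIntegrable (fun s => rlKernel α (t - s)) volume 0 t := by
  have := (intervalIntegrable_rlKernel hα t).comp_sub_left t
  simp only [sub_zero, sub_self] at this
  exact this.symm

/-- The Beta integral, as the convolution identity of the Riemann–Liouville kernels. -/
theorem integral_rlKernel_mul_rlKernel {α γ x : ℝ} (hα : 0 < α) (hγ : 0 < γ) (hx : 0 < x) :
    ∫ s in (0 : ℝ)..x, rlKernel α (x - s) * rlKernel γ s = rlKernel (α + γ) x := by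
  have h1 := Complex.betaIntegral_scaled (γ : ℂ) (α : ℂ) hx
  have h2 : ∫ s in (0 : ℝ)..x, s ^ (γ - 1) * (x - s) ^ (α - 1) =
      x ^ (γ + α - 1) * ProbabilityTheory.beta γ α := by
    rw [ProbabilityTheory.beta_eq_betaIntegralReal γ α hγ hα]
    have h3 : ((∫ s in (0 : ℝ)..x, s ^ (γ - 1) * (x - s) ^ (α - 1) : ℝ) : ℂ) =
        (x : ℂ) ^ ((γ : ℂ) + α - 1) * Complex.betaIntegral γ α := by
      rw [← h1, ← intervalIntegral.integral_ofReal]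
      refine intervalIntegral.integral_congr fun s hs => ?_
      rw [Set.uIcc_of_le hx.le] at hs
      rw [Complex.ofReal_mul, Complex.ofReal_cpow hs.1, Complex.ofReal_cpow (by linarith [hs.2])]
      push_cast
      rfl
    have h4 : (x : ℂ) ^ ((γ : ℂ) + α - 1) = ((x ^ (γ + α - 1) : ℝ) : ℂ) := by
      rw [Complex.ofReal_cpow hx.le]; push_cast; rfl
    rw [h4] at h3
    have := congrArg Complex.re h3
    rwa [Complex.ofReal_re, Complex.re_ofReal_mul] at this
  have h5 : ∀ s, rlKernel α (x - s) * rlKernel γ s =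
      (Real.Gamma α * Real.Gamma γ)⁻¹ * (s ^ (γ - 1) * (x - s) ^ (α - 1)) := fun s => by
    simp only [rlKernel]; rw [mul_inv]; ring
  simp only [h5]
  rw [intervalIntegral.integral_const_mul, h2, ProbabilityTheory.beta, rlKernel, add_comm γ α]
  have := (Real.Gamma_pos_of_pos hα).ne'
  have := (Real.Gamma_pos_of_pos hγ).ne'
  field_simp

theorem intervalIntegrable_rlKernel_mul_rlKernel {α γ x : ℝ} (hα : 0 < α) (hγ : 0 < γ)
    (hx : 0 < x) :
    IntervalIntegrable (fun s => rlKernel α (x - s) * rlKernel γ s) volume 0 x := by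
  rw [intervalIntegrable_iff_integrableOn_Ioc_of_le hx.le]
  -- a function that is not integrable has integral zero
  refine MeasureTheory.Integrable.of_integral_ne_zero ?_
  rw [← intervalIntegral.integral_of_le hx.le, integral_rlKernel_mul_rlKernel hα hγ hx]
  exact (rlKernel_pos (by linarith) hx).ne'

/-- The Riemann–Liouville kernel extended by zero to the whole line. -/
def rlKernel₀ (α : ℝ) : ℝ → ℝ := (Set.Ioi 0).indicator (rlKernel α)

theorem rlKernel₀_nonneg {α : ℝ} (hα : 0 < α) (s : ℝ) : 0 ≤ rlKernel₀ α s :=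
  Set.indicator_nonneg (fun _ hs => rlKernel_nonneg hα (le_of_lt hs)) s

theorem measurable_rlKernel₀ (α : ℝ) : Measurable (rlKernel₀ α) :=
  (measurable_rlKernel α).indicator measurableSet_Ioi

theorem rlKernel₀_mul_rlKernel₀ (α γ t r s : ℝ) :
    rlKernel₀ α (t - s) * rlKernel₀ γ (s - r) =
      (Set.Ioo r t).indicator (fun s => rlKernel α (t - s) * rlKernel γ (s - r)) s := by
  by_cases h1 : s < t <;> by_cases h2 : r < s <;> simp [rlKernel₀, Set.indicator, h1, h2]

theorem integrable_rlKernel₀_mul {α γ : ℝ} (hα : 0 < α) (hγ : 0 < γ) (t r : ℝ) :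
    Integrable (fun s => rlKernel₀ α (t - s) * rlKernel₀ γ (s - r)) := by
  simp only [rlKernel₀_mul_rlKernel₀]
  rw [integrable_indicator_iff measurableSet_Ioo]
  rcases le_or_gt t r with h | h
  · simp [Set.Ioo_eq_empty_of_le h]
  rw [← integrableOn_Ioc_iff_integrableOn_Ioo, ← intervalIntegrable_iff_integrableOn_Ioc_of_le h.le]
  have := (intervalIntegrable_rlKernel_mul_rlKernel hα hγ (sub_pos.2 h)).comp_sub_right r
  simpa using this

theorem integral_rlKernel₀_mul {α γ : ℝ} (hα : 0 < α) (hγ : 0 < γ) (t r : ℝ) :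
    ∫ s, rlKernel₀ α (t - s) * rlKernel₀ γ (s - r) = rlKernel₀ (α + γ) (t - r) := by
  simp only [rlKernel₀_mul_rlKernel₀]
  rw [integral_indicator measurableSet_Ioo]
  rcases le_or_gt t r with h | h
  · simp [rlKernel₀, h]
  rw [← integral_Ioc_eq_integral_Ioo, ← intervalIntegral.integral_of_le h.le, rlKernel₀,
    Set.indicator_of_mem (Set.mem_Ioi.2 (sub_pos.2 h)),
    ← integral_rlKernel_mul_rlKernel hα hγ (sub_pos.2 h)]
  have := intervalIntegral.integral_comp_sub_right
    (f := fun s => rlKernel α (t - r - s) * rlKernel γ s) (a := r) (b := t) r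
  simpa using this

theorem fracInt_eq_integral {γ : ℝ} (h : ℝ → ℝ) {s t : ℝ} (hs : 0 ≤ s) (hst : s ≤ t) :
    fracInt γ h s = ∫ r, rlKernel₀ γ (s - r) * (Set.Ioc 0 t).indicator h r := by
  have : ∀ r, rlKernel₀ γ (s - r) * (Set.Ioc 0 t).indicator h r =
      (Set.Ioo 0 s).indicator (fun r => rlKernel γ (s - r) * h r) r := fun r => by
    by_cases h1 : r < s
    · have : r ≤ t := by linarith
      by_cases h2 : 0 < r <;> simp [rlKernel₀, Set.indicator, h1, h2, this]
    · simp [rlKernel₀, Set.indicator, h1]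
  simp only [this]
  rw [integral_indicator measurableSet_Ioo, ← integral_Ioc_eq_integral_Ioo,
    ← intervalIntegral.integral_of_le hs, fracInt]

/-- The semigroup property of fractional integration, by Tonelli's theorem and the Beta
integral. -/
theorem fracInt_fracInt {α γ : ℝ} (hα : 0 < α) (hγ : 0 < γ) (hαγ : 1 ≤ α + γ) {h : ℝ → ℝ}
    {t : ℝ} (ht : 0 ≤ t) (hh : IntervalIntegrable h volume 0 t) :
    fracInt α (fracInt γ h) t = fracInt (α + γ) h t := by
  set H : ℝ → ℝ := (Set.Ioc 0 t).indicator h with hH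
  have hHint : Integrable H := by
    rw [hH, integrable_indicator_iff measurableSet_Ioc]
    exact (intervalIntegrable_iff_integrableOn_Ioc_of_le ht).1 hh
  set F : ℝ × ℝ → ℝ := fun p => rlKernel₀ α (t - p.1) * rlKernel₀ γ (p.1 - p.2) * H p.2 with hF
  have hFm : AEStronglyMeasurable F (volume.prod volume) := by
    refine AEStronglyMeasurable.mul (Measurable.aestronglyMeasurable ?_)
      hHint.aestronglyMeasurable.comp_snd
    exact ((measurable_rlKernel₀ α).comp (by fun_prop)).mul
      ((measurable_rlKernel₀ γ).comp (by fun_prop))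
  have hFi : Integrable F (volume.prod volume) := by
    rw [integrable_prod_iff' hFm]
    refine ⟨Eventually.of_forall fun r => (integrable_rlKernel₀_mul hα hγ t r).mul_const (H r), ?_⟩
    have : ∀ r, ∫ s, ‖F (s, r)‖ = rlKernel₀ (α + γ) (t - r) * ‖H r‖ := fun r => by
      rw [← integral_rlKernel₀_mul hα hγ t r, ← integral_mul_const]
      congr 1
      ext s
      rw [hF, norm_mul, Real.norm_of_nonneg
        (mul_nonneg (rlKernel₀_nonneg hα _) (rlKernel₀_nonneg hγ _))]
    simp only [this]
    refine Integrable.mono' (hHint.norm.const_mul (rlKernel (α + γ) t)) ?_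
      (Eventually.of_forall fun r => ?_)
    · exact ((measurable_rlKernel₀ _).comp (by fun_prop)).aestronglyMeasurable.mul
        hHint.norm.aestronglyMeasurable
    · by_cases hr : r ∈ Set.Ioc 0 t
      · rw [norm_mul, norm_norm, Real.norm_of_nonneg (rlKernel₀_nonneg (by linarith) _)]
        refine mul_le_mul_of_nonneg_right ?_ (norm_nonneg _)
        refine Set.indicator_apply_le' (fun h0 => ?_) fun _ => rlKernel_nonneg (by linarith) ht
        exact rlKernel_le_rlKernel hαγ (le_of_lt h0) (by linarith [hr.1])
      · simp [hH, hr]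
  have hL : fracInt α (fracInt γ h) t = ∫ s, ∫ r, F (s, r) := by
    rw [fracInt_eq_integral (fracInt γ h) ht le_rfl]
    congr 1
    ext s
    simp only [hF, mul_assoc]
    rw [integral_const_mul]
    by_cases h1 : s < t
    · by_cases h2 : 0 < s
      · rw [Set.indicator_of_mem (Set.mem_Ioc.2 ⟨h2, h1.le⟩), fracInt_eq_integral h h2.le h1.le]
      · rw [Set.indicator_of_notMem (fun h => h2 h.1), mul_zero, integral_eq_zero_of_ae, mul_zero]
        refine Eventually.of_forall fun r => ?_
        by_cases h3 : 0 < r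
        · have : ¬ (0 < s - r) := by linarith
          simp [rlKernel₀, this]
        · simp [hH, h3]
    · simp [rlKernel₀, h1]
  rw [hL, integral_integral_swap hFi, fracInt_eq_integral h ht le_rfl]
  congr 1
  ext r
  rw [← integral_rlKernel₀_mul hα hγ t r, ← integral_mul_const]

theorem fracInt_rlKernel {α γ t : ℝ} (hα : 0 < α) (hγ : 0 < γ) (ht : 0 < t) :
    fracInt α (rlKernel γ) t = rlKernel (α + γ) t :=
  integral_rlKernel_mul_rlKernel hα hγ ht

theorem fracInt_const_mul (α c : ℝ) (h : ℝ → ℝ) (t : ℝ) :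
    fracInt α (fun s => c * h s) t = c * fracInt α h t := by
  simp only [fracInt]
  rw [← intervalIntegral.integral_const_mul]
  exact intervalIntegral.integral_congr fun s _ => by ring

theorem fracInt_const {α : ℝ} (hα : 0 < α) (c : ℝ) {t : ℝ} (ht : 0 ≤ t) :
    fracInt α (fun _ => c) t = c * rlKernel (α + 1) t := by
  rcases ht.eq_or_lt with rfl | ht
  · simp [fracInt, rlKernel, hα.ne']
  · rw [← fracInt_rlKernel hα one_pos ht, ← fracInt_const_mul]
    simp only [rlKernel_one, mul_one]

theorem fracInt_one (h : ℝ → ℝ) (t : ℝ) : fracInt 1 h t = ∫ s in (0 : ℝ)..t, h s := by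
  simp [fracInt, rlKernel_one]

theorem fracInt_congr {α : ℝ} {h₁ h₂ : ℝ → ℝ} {t : ℝ} (ht : 0 ≤ t)
    (h : ∀ s ∈ Set.Icc 0 t, h₁ s = h₂ s) : fracInt α h₁ t = fracInt α h₂ t := by
  refine intervalIntegral.integral_congr fun s hs => ?_
  rw [Set.uIcc_of_le ht] at hs
  simp only [h s hs]

theorem fracInt_congr_Ioo {α : ℝ} {h₁ h₂ : ℝ → ℝ} {t : ℝ} (ht : 0 ≤ t)
    (h : ∀ s ∈ Set.Ioo 0 t, h₁ s = h₂ s) : fracInt α h₁ t = fracInt α h₂ t := by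
  simp only [fracInt]
  rw [intervalIntegral.integral_of_le ht, intervalIntegral.integral_of_le ht,
    integral_Ioc_eq_integral_Ioo, integral_Ioc_eq_integral_Ioo]
  exact setIntegral_congr_fun measurableSet_Ioo fun s hs => by simp only [h s hs]

theorem intervalIntegrable_rlKernel_sub_mul {α : ℝ} (hα : 0 < α) {h : ℝ → ℝ} {t : ℝ} (ht : 0 ≤ t)
    (hh : ContinuousOn h (Set.Icc 0 t)) :
    IntervalIntegrable (fun s => rlKernel α (t - s) * h s) volume 0 t :=
  (intervalIntegrable_rlKernel_sub hα t).mul_continuousOn (by rwa [Set.uIcc_of_le ht])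

theorem fracInt_add {α : ℝ} {h₁ h₂ : ℝ → ℝ} {t : ℝ}
    (H₁ : IntervalIntegrable (fun s => rlKernel α (t - s) * h₁ s) volume 0 t)
    (H₂ : IntervalIntegrable (fun s => rlKernel α (t - s) * h₂ s) volume 0 t) :
    fracInt α (fun s => h₁ s + h₂ s) t = fracInt α h₁ t + fracInt α h₂ t := by
  simp only [fracInt]
  rw [← intervalIntegral.integral_add H₁ H₂]
  exact intervalIntegral.integral_congr fun s _ => by ring

theorem abs_fracInt_le {α : ℝ} (hα : 0 < α) {h : ℝ → ℝ} {t M : ℝ} (ht : 0 ≤ t)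
    (hM : ∀ s ∈ Set.Icc 0 t, |h s| ≤ M) : |fracInt α h t| ≤ M * rlKernel (α + 1) t := by
  rw [← fracInt_const hα M ht, ← Real.norm_eq_abs]
  refine intervalIntegral.norm_integral_le_of_norm_le ht (Eventually.of_forall fun s hs => ?_)
    ((intervalIntegrable_rlKernel_sub hα t).mul_const M)
  rw [norm_mul, Real.norm_of_nonneg (rlKernel_nonneg hα (by linarith [hs.2])), Real.norm_eq_abs]
  exact mul_le_mul_of_nonneg_left (hM s ⟨hs.1.le, hs.2⟩)
    (rlKernel_nonneg hα (by linarith [hs.2]))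

theorem fracInt_eq_rpow_mul {α : ℝ} (hα : 0 < α) (h : ℝ → ℝ) {t : ℝ} (ht : 0 ≤ t) :
    fracInt α h t = t ^ α * ∫ x in (0 : ℝ)..1, rlKernel α (1 - x) * h (t * x) := by
  rcases ht.eq_or_lt with rfl | ht
  · simp [fracInt, Real.zero_rpow hα.ne']
  have h1 := intervalIntegral.integral_comp_mul_left
    (fun s => rlKernel α (t - s) * h s) (a := 0) (b := 1) ht.ne'
  rw [mul_zero, mul_one, smul_eq_mul] at h1
  rw [fracInt, ← mul_inv_cancel_left₀ ht.ne' (∫ s in (0 : ℝ)..t, _), ← h1,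
    ← intervalIntegral.integral_const_mul, ← intervalIntegral.integral_const_mul]
  refine intervalIntegral.integral_congr fun x hx => ?_
  rw [Set.uIcc_of_le zero_le_one] at hx
  have e : t - t * x = t * (1 - x) := by ring
  simp only [rlKernel]
  rw [e, Real.mul_rpow ht.le (by linarith [hx.2]), Real.rpow_sub_one ht.ne']
  field_simp

/-- The kernel is singular for `α < 1`; after rescaling to `[0, 1]` the singularity no longer moves
with `t`, and dominated convergence applies. -/
theorem continuousOn_fracInt {α a : ℝ} (hα : 0 < α) {h : ℝ → ℝ}
    (hh : ContinuousOn h (Set.Icc 0 a)) : ContinuousOn (fracInt α h) (Set.Icc 0 a) := by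
  have : ∀ t ∈ Set.Icc 0 a, fracInt α h t =
      t ^ α * ∫ x in (0 : ℝ)..1, rlKernel α (1 - x) * h (t * x) :=
    fun t ht => fracInt_eq_rpow_mul hα h ht.1
  refine ContinuousOn.congr ?_ this
  refine (Real.continuous_rpow_const hα.le).continuousOn.mul fun t₀ ht₀ => ?_
  obtain ⟨M, hM⟩ := isCompact_Icc.exists_bound_of_continuousOn hh
  have hmem : ∀ t ∈ Set.Icc 0 a, ∀ x ∈ Set.Icc (0 : ℝ) 1, t * x ∈ Set.Icc 0 a :=
    fun t ht x hx => ⟨mul_nonneg ht.1 hx.1, (mul_le_of_le_one_right ht.1 hx.2).trans ht.2⟩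
  refine intervalIntegral.continuousWithinAt_of_dominated_interval
    (bound := fun x => rlKernel α (1 - x) * M) ?_ ?_
    ((intervalIntegrable_rlKernel_sub hα 1).mul_const M) ?_
  · filter_upwards [self_mem_nhdsWithin] with t ht
    refine (((measurable_rlKernel α).comp (by fun_prop)).aestronglyMeasurable).mul ?_
    rw [Set.uIoc_of_le zero_le_one]
    refine ContinuousOn.aestronglyMeasurable ?_ measurableSet_Ioc
    exact hh.comp (by fun_prop) fun x hx => hmem t ht x ⟨hx.1.le, hx.2⟩
  · filter_upwards [self_mem_nhdsWithin] with t ht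
    refine Eventually.of_forall fun x hx => ?_
    rw [Set.uIoc_of_le zero_le_one] at hx
    have h0 : 0 ≤ rlKernel α (1 - x) := rlKernel_nonneg hα (by linarith [hx.2])
    rw [norm_mul, Real.norm_of_nonneg h0]
    exact mul_le_mul_of_nonneg_left (hM _ (hmem t ht x ⟨hx.1.le, hx.2⟩)) h0
  · refine Eventually.of_forall fun x hx => ?_
    rw [Set.uIoc_of_le zero_le_one] at hx
    refine continuousWithinAt_const.mul ?_
    have := hh.comp (f := fun t => t * x) (s := Set.Icc 0 a) (by fun_prop)
      fun t ht => hmem t ht x ⟨hx.1.le, hx.2⟩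
    exact this t₀ ht₀

/-- The fundamental theorem of calculus for a primitive of a function that is continuous only on
the closed interval. -/
theorem hasDerivWithinAt_integral {a : ℝ} (ha : 0 ≤ a) {h : ℝ → ℝ}
    (hh : ContinuousOn h (Set.Icc 0 a)) {t : ℝ} (ht : t ∈ Set.Icc 0 a) :
    HasDerivWithinAt (fun t => ∫ s in (0 : ℝ)..t, h s) (h t) (Set.Icc 0 a) t := by
  set H : ℝ → ℝ := Set.IccExtend ha ((Set.Icc 0 a).domRestrict h) with hH
  have hHc : Continuous H := hh.domRestrict.Icc_extend'
  have hHe : ∀ s ∈ Set.Icc 0 a, H s = h s := fun s hs => by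
    rw [hH, Set.IccExtend_of_mem ha _ hs]; rfl
  have h1 := (hHc.integral_hasStrictDerivAt 0 t).hasDerivAt.hasDerivWithinAt (s := Set.Icc 0 a)
  rw [hHe t ht] at h1
  refine h1.congr_of_mem (fun x hx => ?_) ht
  refine intervalIntegral.integral_congr fun s hs => ?_
  rw [Set.uIcc_of_le hx.1] at hs
  exact (hHe s ⟨hs.1, hs.2.trans hx.2⟩).symm

theorem hasDerivWithinAt_fracInt_add_one {α a : ℝ} (hα : 0 < α) (ha : 0 ≤ a) {h : ℝ → ℝ}
    (hh : ContinuousOn h (Set.Icc 0 a)) {t : ℝ} (ht : t ∈ Set.Icc 0 a) :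
    HasDerivWithinAt (fracInt (α + 1) h) (fracInt α h t) (Set.Icc 0 a) t := by
  refine (hasDerivWithinAt_integral ha (continuousOn_fracInt hα hh) ht).congr_of_mem
    (fun x hx => ?_) ht
  rw [add_comm α 1, ← fracInt_one, fracInt_fracInt one_pos hα (by linarith) hx.1]
  exact ContinuousOn.intervalIntegrable_of_Icc hx.1 (hh.mono (Set.Icc_subset_Icc_right hx.2))

/-- Integration by parts for the fractional integral of a `C¹` function. -/
theorem fracInt_eq_add_fracInt_deriv {α a : ℝ} (hα : 0 < α) {h h' : ℝ → ℝ}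
    (hd : ∀ t ∈ Set.Icc 0 a, HasDerivWithinAt h (h' t) (Set.Icc 0 a) t)
    (hc : ContinuousOn h' (Set.Icc 0 a)) {t : ℝ} (ht : t ∈ Set.Icc 0 a) :
    fracInt α h t = h 0 * rlKernel (α + 1) t + fracInt (α + 1) h' t := by
  have hsub : ∀ s ∈ Set.Icc 0 t, s ∈ Set.Icc 0 a := fun s hs => ⟨hs.1, hs.2.trans ht.2⟩
  have hi : ∀ s ∈ Set.Icc 0 t, IntervalIntegrable h' volume 0 s := fun s hs =>
    ContinuousOn.intervalIntegrable_of_Icc hs.1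
      (hc.mono (Set.Icc_subset_Icc_right (hs.2.trans ht.2)))
  have h1 : ∀ s ∈ Set.Icc 0 t, h s = h 0 + fracInt 1 h' s := fun s hs => by
    rw [fracInt_one, intervalIntegral.integral_eq_sub_of_hasDerivAt_of_le hs.1 (f := h)]
    · ring
    · exact fun x hx => ((hd x ⟨hx.1, hx.2.trans (hsub s hs).2⟩).continuousWithinAt).mono
        (Set.Icc_subset_Icc_right (hsub s hs).2)
    · exact fun x hx => (hd x ⟨hx.1.le, hx.2.le.trans (hsub s hs).2⟩).hasDerivAt
        (Icc_mem_nhds hx.1 (hx.2.trans_le (hsub s hs).2))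
    · exact hi s hs
  rw [fracInt_congr ht.1 h1, fracInt_add, fracInt_const hα _ ht.1,
    fracInt_fracInt hα one_pos (by linarith) ht.1 (hi t ⟨ht.1, le_rfl⟩)]
  · exact intervalIntegrable_rlKernel_sub_mul hα ht.1 continuousOn_const
  · exact intervalIntegrable_rlKernel_sub_mul hα ht.1
      ((continuousOn_fracInt one_pos hc).mono (Set.Icc_subset_Icc_right ht.2))

/-! ### The Mittag-Leffler resolvent of the fractional integral -/

/-- The kernel `s ^ (β - 1) E_{β,β}(μ s ^ β)` of the mild formulation. -/
def mlKernel (β μ s : ℝ) : ℝ := s ^ (β - 1) * mittagLeffler β β (μ * s ^ β)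

/-- Convolution with the kernel `mlKernel β μ`; it is the operator
`I^β (1 - μ I^β)⁻¹ = ∑ j, μ ^ j I^(β j + β)`. -/
def mlConv (β μ : ℝ) (h : ℝ → ℝ) (t : ℝ) : ℝ := ∫ s in (0 : ℝ)..t, mlKernel β μ (t - s) * h s

theorem continuous_mlKernel {β : ℝ} (hβ : 1 ≤ β) (μ : ℝ) : Continuous (mlKernel β μ) :=
  (Real.continuous_rpow_const (by linarith)).mul ((continuous_mittagLeffler hβ hβ).comp
    (continuous_const.mul (Real.continuous_rpow_const (by linarith))))

theorem mlKernel_nonneg {β μ s : ℝ} (hβ : 1 ≤ β) (hμ : 0 ≤ μ) (hs : 0 ≤ s) :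
    0 ≤ mlKernel β μ s :=
  mul_nonneg (Real.rpow_nonneg hs _)
    (mittagLeffler_nonneg hβ hβ (mul_nonneg hμ (Real.rpow_nonneg hs _)))

theorem hasSum_mlKernel {β : ℝ} (hβ : 1 ≤ β) (μ : ℝ) {s : ℝ} (hs : 0 ≤ s) :
    HasSum (fun j : ℕ => μ ^ j * rlKernel (β * j + β) s) (mlKernel β μ s) :=
  hasSum_rlKernel hβ hβ μ hs

/-- The series of fractional integrals defining `mlConv`, by integrating `hasSum_mlKernel` term by
term. -/
theorem hasSum_mlConv {β μ : ℝ} (hβ : 1 ≤ β) (hμ : 0 ≤ μ) {h : ℝ → ℝ} {t : ℝ} (ht : 0 ≤ t)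
    (hh : ContinuousOn h (Set.Icc 0 t)) :
    HasSum (fun j : ℕ => μ ^ j * fracInt (β * j + β) h t) (mlConv β μ h t) := by
  obtain ⟨M, hM⟩ := isCompact_Icc.exists_bound_of_continuousOn hh
  have hexp : ∀ j : ℕ, 1 ≤ β * j + β := fun j => by
    have : 0 ≤ β * j := by positivity
    linarith
  have hm : AEStronglyMeasurable h (volume.restrict (Set.uIoc 0 t)) := by
    rw [Set.uIoc_of_le ht]
    exact (hh.mono Set.Ioc_subset_Icc_self).aestronglyMeasurable measurableSet_Ioc
  have := intervalIntegral.hasSum_integral_of_dominated_convergence (μ := volume) (a := 0) (b := t)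
    (F := fun (j : ℕ) s => μ ^ j * (rlKernel (β * j + β) (t - s) * h s))
    (f := fun s => mlKernel β μ (t - s) * h s)
    (fun (j : ℕ) _ => μ ^ j * rlKernel (β * j + β) t * M) (fun j => ?_) (fun j => ?_) ?_ ?_ ?_
  · simpa only [intervalIntegral.integral_const_mul, mlConv, fracInt] using this
  · exact ((((measurable_rlKernel _).comp (by fun_prop)).aestronglyMeasurable).mul hm).const_mul _
  · refine Eventually.of_forall fun s hs => ?_
    rw [Set.uIoc_of_le ht] at hs
    have h0 : 0 ≤ t - s := by linarith [hs.2]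
    have h1 : 0 ≤ rlKernel (β * j + β) (t - s) := rlKernel_nonneg (by linarith [hexp j]) h0
    rw [norm_mul, norm_mul, Real.norm_of_nonneg (pow_nonneg hμ j), Real.norm_of_nonneg h1,
      ← mul_assoc]
    refine mul_le_mul (mul_le_mul_of_nonneg_left ?_ (pow_nonneg hμ j)) (hM s ⟨hs.1.le, hs.2⟩)
      (norm_nonneg _) ?_
    · exact rlKernel_le_rlKernel (hexp j) h0 (by linarith [hs.1])
    · exact mul_nonneg (pow_nonneg hμ j) (rlKernel_nonneg (by linarith [hexp j]) ht)
  · exact Eventually.of_forall fun s _ => (hasSum_mlKernel hβ μ ht).summable.mul_right M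
  · exact intervalIntegrable_const
  · refine Eventually.of_forall fun s hs => ?_
    rw [Set.uIoc_of_le ht] at hs
    simpa only [mul_assoc] using (hasSum_mlKernel hβ μ (by linarith [hs.2])).mul_right (h s)

/-- The convolution of two continuous functions is continuous. -/
theorem continuousOn_integral_sub_mul {k : ℝ → ℝ} (hk : Continuous k) {h : ℝ → ℝ} {a : ℝ}
    (hh : ContinuousOn h (Set.Icc 0 a)) :
    ContinuousOn (fun t => ∫ s in (0 : ℝ)..t, k (t - s) * h s) (Set.Icc 0 a) := by
  rcases lt_or_ge a 0 with ha | ha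
  · simp [Set.Icc_eq_empty_of_lt ha]
  set H : ℝ → ℝ := Set.IccExtend ha ((Set.Icc 0 a).domRestrict h) with hH
  have hHc : Continuous H := hh.domRestrict.Icc_extend'
  have hHe : ∀ s ∈ Set.Icc 0 a, H s = h s := fun s hs => by
    rw [hH, Set.IccExtend_of_mem ha _ hs]; rfl
  have hc : Continuous fun t => ∫ s in (0 : ℝ)..t, k (t - s) * H s :=
    intervalIntegral.continuous_parametric_intervalIntegral_of_continuous
      (f := fun t s => k (t - s) * H s) (by fun_prop) continuous_id
  refine hc.continuousOn.congr fun t ht => intervalIntegral.integral_congr fun s hs => ?_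
  rw [Set.uIcc_of_le ht.1] at hs
  simp only [hHe s ⟨hs.1, hs.2.trans ht.2⟩]

theorem continuousOn_mlConv {β : ℝ} (hβ : 1 ≤ β) (μ : ℝ) {h : ℝ → ℝ} {a : ℝ}
    (hh : ContinuousOn h (Set.Icc 0 a)) : ContinuousOn (mlConv β μ h) (Set.Icc 0 a) :=
  continuousOn_integral_sub_mul (continuous_mlKernel hβ μ) hh

/-- The resolvent identity for `mlConv`, obtained by integrating its series term by term. -/
theorem mlConv_eq {β μ : ℝ} (hβ : 1 ≤ β) (hμ : 0 ≤ μ) {h : ℝ → ℝ} {t : ℝ} (ht : 0 ≤ t)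
    (hh : ContinuousOn h (Set.Icc 0 t)) :
    mlConv β μ h t = fracInt β h t + μ * fracInt β (mlConv β μ h) t := by
  obtain ⟨M, hM⟩ := isCompact_Icc.exists_bound_of_continuousOn hh
  have hM0 : 0 ≤ M := (norm_nonneg _).trans (hM 0 ⟨le_rfl, ht⟩)
  have hpos : ∀ j : ℕ, 0 < β * j + β := fun j => by positivity
  have hi : IntervalIntegrable h volume 0 t := hh.intervalIntegrable_of_Icc ht
  have hmono : ∀ s ∈ Set.Icc 0 t, ContinuousOn h (Set.Icc 0 s) := fun s hs =>
    hh.mono (Set.Icc_subset_Icc_right hs.2)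
  have key : HasSum (fun j : ℕ => μ ^ j * fracInt (β * (j + 1 : ℕ) + β) h t)
      (fracInt β (mlConv β μ h) t) := by
    have := intervalIntegral.hasSum_integral_of_dominated_convergence (μ := volume) (a := 0)
      (b := t) (F := fun (j : ℕ) s => rlKernel β (t - s) * (μ ^ j * fracInt (β * j + β) h s))
      (f := fun s => rlKernel β (t - s) * mlConv β μ h s)
      (fun (j : ℕ) _ => rlKernel β t * (μ ^ j * (M * rlKernel (β * j + (β + 1)) t)))
      (fun j => ?_) (fun j => ?_) ?_ ?_ ?_
    · have e : ∀ j : ℕ, ∫ s in (0 : ℝ)..t, rlKernel β (t - s) * (μ ^ j * fracInt (β * j + β) h s) =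
          μ ^ j * fracInt (β * (j + 1 : ℕ) + β) h t := fun j => by
        have h1 := fracInt_const_mul β (μ ^ j) (fracInt (β * j + β) h) t
        rw [fracInt_fracInt (by linarith) (hpos j) (by linarith [hpos j]) ht hi] at h1
        rw [← fracInt, h1]
        congr 2
        push_cast; ring
      simp only [e] at this
      exact this
    · refine (((measurable_rlKernel _).comp (by fun_prop)).aestronglyMeasurable).mul
        (AEStronglyMeasurable.const_mul ?_ _)
      rw [Set.uIoc_of_le ht]
      exact ((continuousOn_fracInt (hpos j) hh).mono
        Set.Ioc_subset_Icc_self).aestronglyMeasurable measurableSet_Ioc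
    · refine Eventually.of_forall fun s hs => ?_
      rw [Set.uIoc_of_le ht] at hs
      have hs' : s ∈ Set.Icc 0 t := ⟨hs.1.le, hs.2⟩
      have h0 : 0 ≤ t - s := by linarith [hs.2]
      rw [norm_mul, norm_mul, Real.norm_of_nonneg (pow_nonneg hμ j),
        Real.norm_of_nonneg (rlKernel_nonneg (by linarith) h0)]
      refine mul_le_mul (rlKernel_le_rlKernel hβ h0 (by linarith [hs.1]))
        (mul_le_mul_of_nonneg_left ?_ (pow_nonneg hμ j)) (by positivity)
        (rlKernel_nonneg (by linarith) ht)
      refine (abs_fracInt_le (hpos j) hs'.1 fun x hx => hM x ⟨hx.1, hx.2.trans hs'.2⟩).trans ?_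
      rw [add_assoc]
      exact mul_le_mul_of_nonneg_left
        (rlKernel_le_rlKernel (by linarith [hpos j]) hs'.1 hs'.2) hM0
    · refine Eventually.of_forall fun s _ => Summable.mul_left _ ?_
      have := (hasSum_rlKernel hβ (show 1 ≤ β + 1 by linarith) μ ht).summable.mul_left M
      refine this.congr fun j => by ring
    · exact intervalIntegrable_const
    · refine Eventually.of_forall fun s hs => ?_
      rw [Set.uIoc_of_le ht] at hs
      exact (hasSum_mlConv hβ hμ hs.1.le (hmono s ⟨hs.1.le, hs.2⟩)).mul_left _
  have h0 := hasSum_mlConv hβ hμ ht hh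
  have h1 := (hasSum_nat_add_iff' 1).2 h0
  have h2 := key.mul_left μ
  have h3 : (fun j : ℕ => μ * (μ ^ j * fracInt (β * (j + 1 : ℕ) + β) h t)) =
      fun j : ℕ => μ ^ (j + 1) * fracInt (β * (j + 1 : ℕ) + β) h t := by
    ext j; ring
  rw [h3] at h2
  have := h1.unique h2
  simp only [Finset.range_one, Finset.sum_singleton, pow_zero, one_mul, Nat.cast_zero, mul_zero,
    zero_add] at this
  linarith

/-- The homogeneous equation `d = μ I^β d` has only the zero solution: all terms of the convergent
series of `mlConv β μ d` are equal. -/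
theorem eq_zero_of_eq_mul_fracInt {β μ a : ℝ} (hβ : 1 ≤ β) (hμ : 0 ≤ μ) {d : ℝ → ℝ}
    (hd : ContinuousOn d (Set.Icc 0 a)) (h : ∀ t ∈ Set.Icc 0 a, d t = μ * fracInt β d t) {t : ℝ}
    (ht : t ∈ Set.Icc 0 a) : d t = 0 := by
  have hpos : ∀ j : ℕ, 0 < β * j + β := fun j => by positivity
  have hdt := hd.mono (Set.Icc_subset_Icc_right ht.2)
  have hconst : ∀ j : ℕ, μ ^ j * fracInt (β * j + β) d t = fracInt β d t := fun j => by
    induction j with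
    | zero => simp
    | succ j ih =>
      have e : fracInt (β * j + β) d t = μ * fracInt (β * (j + 1 : ℕ) + β) d t := by
        rw [fracInt_congr ht.1 fun s hs => h s ⟨hs.1, hs.2.trans ht.2⟩, fracInt_const_mul,
          fracInt_fracInt (hpos j) (by linarith) (by linarith [hpos j]) ht.1
            (hdt.intervalIntegrable_of_Icc ht.1)]
        push_cast
        rw [mul_add, mul_one]
      rw [← ih, e]
      ring
  have hs := (hasSum_mlConv hβ hμ ht.1 hdt).summable
  simp only [hconst] at hs
  rw [h t ht, (summable_const_iff _).1 hs, mul_zero]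

theorem mittagLeffler_one_eq {β μ : ℝ} (hβ : 1 ≤ β) (hμ : 0 ≤ μ) {t : ℝ} (ht : 0 ≤ t) :
    mittagLeffler β 1 (μ * t ^ β) = 1 + μ * mlConv β μ (fun _ => 1) t := by
  have h0 := hasSum_rlKernel hβ le_rfl μ ht
  simp only [sub_self, Real.rpow_zero, one_mul] at h0
  have h1 := (hasSum_nat_add_iff' 1).2 h0
  have h2 := (hasSum_mlConv hβ hμ ht (h := fun _ => 1) continuousOn_const).mul_left μ
  have h3 : (fun j : ℕ => μ * (μ ^ j * fracInt (β * j + β) (fun _ => 1) t)) =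
      fun j : ℕ => μ ^ (j + 1) * rlKernel (β * (j + 1 : ℕ) + 1) t := by
    ext j
    rw [fracInt_const (by positivity) _ ht, one_mul]
    push_cast
    rw [show β * j + β + 1 = β * (j + 1) + 1 by ring]
    ring
  rw [h3] at h2
  have := h1.unique h2
  simp only [Finset.range_one, Finset.sum_singleton, pow_zero, one_mul, Nat.cast_zero, mul_zero,
    zero_add, rlKernel_one] at this
  linarith

theorem mlConv_add {β μ : ℝ} (hβ : 1 ≤ β) {h₁ h₂ : ℝ → ℝ} {t : ℝ} (ht : 0 ≤ t)
    (H₁ : ContinuousOn h₁ (Set.Icc 0 t)) (H₂ : ContinuousOn h₂ (Set.Icc 0 t)) :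
    mlConv β μ (fun s => h₁ s + h₂ s) t = mlConv β μ h₁ t + mlConv β μ h₂ t := by
  have hk : Continuous fun s => mlKernel β μ (t - s) :=
    (continuous_mlKernel hβ μ).comp (by fun_prop)
  simp only [mlConv]
  rw [← intervalIntegral.integral_add]
  · exact intervalIntegral.integral_congr fun s _ => by ring
  · exact (hk.continuousOn.mul H₁).intervalIntegrable_of_Icc ht
  · exact (hk.continuousOn.mul H₂).intervalIntegrable_of_Icc ht

theorem mlConv_const_mul (β μ c : ℝ) (h : ℝ → ℝ) (t : ℝ) :
    mlConv β μ (fun s => c * h s) t = c * mlConv β μ h t := by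
  simp only [mlConv]
  rw [← intervalIntegral.integral_const_mul]
  exact intervalIntegral.integral_congr fun s _ => by ring

/-- The free term `c E_{β,1}` is absorbed into the convolution as a constant source `c μ`. -/
theorem mul_mittagLeffler_add_mlConv {β μ : ℝ} (hβ : 1 ≤ β) (hμ : 0 ≤ μ) (c : ℝ) {f : ℝ → ℝ}
    {t : ℝ} (ht : 0 ≤ t) (hf : ContinuousOn f (Set.Icc 0 t)) :
    c * mittagLeffler β 1 (μ * t ^ β) + mlConv β μ f t =
      c + mlConv β μ (fun s => c * μ + f s) t := by
  have h1 := mlConv_const_mul β μ (c * μ) (fun _ => 1) t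
  simp only [mul_one] at h1
  rw [mlConv_add hβ ht continuousOn_const hf, h1, mittagLeffler_one_eq hβ hμ ht]
  ring

/-- Variation of constants: the equation `w = c + I^β (μ w + f)` is solved by its Mittag-Leffler
representation. -/
theorem eq_mittagLeffler_iff {β μ a c : ℝ} (hβ : 1 ≤ β) (hμ : 0 ≤ μ) {w f : ℝ → ℝ}
    (hw : ContinuousOn w (Set.Icc 0 a)) (hf : ContinuousOn f (Set.Icc 0 a)) :
    (∀ t ∈ Set.Icc 0 a, w t = c * mittagLeffler β 1 (μ * t ^ β) + mlConv β μ f t) ↔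
      ∀ t ∈ Set.Icc 0 a, w t = c + fracInt β (fun s => μ * w s + f s) t := by
  have hβ0 : 0 < β := by linarith
  set h : ℝ → ℝ := fun s => c * μ + f s with hh
  have hhc : ContinuousOn h (Set.Icc 0 a) := continuousOn_const.add hf
  have sub : ∀ t ∈ Set.Icc 0 a, Set.Icc 0 t ⊆ Set.Icc 0 a := fun t ht =>
    Set.Icc_subset_Icc_right ht.2
  -- both equations are shifted to homogeneous initial values
  have e1 : ∀ t ∈ Set.Icc 0 a,
      c * mittagLeffler β 1 (μ * t ^ β) + mlConv β μ f t = c + mlConv β μ h t := fun t ht =>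
    mul_mittagLeffler_add_mlConv hβ hμ c ht.1 (hf.mono (sub t ht))
  have e2 : ∀ t ∈ Set.Icc 0 a, fracInt β (fun s => μ * w s + f s) t =
      fracInt β h t + μ * fracInt β (fun s => w s - c) t := fun t ht => by
    rw [← fracInt_const_mul, ← fracInt_add]
    · exact fracInt_congr ht.1 fun s _ => by simp only [hh]; ring
    · exact intervalIntegrable_rlKernel_sub_mul hβ0 ht.1 (hhc.mono (sub t ht))
    · exact intervalIntegrable_rlKernel_sub_mul hβ0 ht.1
        (continuousOn_const.mul ((hw.mono (sub t ht)).sub continuousOn_const))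
  have e3 : ∀ t ∈ Set.Icc 0 a, mlConv β μ h t = fracInt β h t + μ * fracInt β (mlConv β μ h) t :=
    fun t ht => mlConv_eq hβ hμ ht.1 (hhc.mono (sub t ht))
  constructor
  · intro H t ht
    rw [H t ht, e1 t ht, e2 t ht, e3 t ht]
    congr 3
    exact fracInt_congr ht.1 fun s hs => by
      rw [H s (sub t ht hs), e1 s (sub t ht hs)]; ring
  · intro H t ht
    have hd : w t - c - mlConv β μ h t = 0 := by
      refine eq_zero_of_eq_mul_fracInt (d := fun t => w t - c - mlConv β μ h t) hβ hμ
        ((hw.sub continuousOn_const).sub (continuousOn_mlConv hβ μ hhc)) (fun t ht => ?_) ht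
      have h1 : fracInt β (fun s => w s - c) t =
          fracInt β (fun s => w s - c - mlConv β μ h s) t + fracInt β (mlConv β μ h) t := by
        rw [← fracInt_add]
        · exact fracInt_congr ht.1 fun s _ => by ring
        · exact intervalIntegrable_rlKernel_sub_mul hβ0 ht.1
            (((hw.sub continuousOn_const).sub (continuousOn_mlConv hβ μ hhc)).mono (sub t ht))
        · exact intervalIntegrable_rlKernel_sub_mul hβ0 ht.1
            ((continuousOn_mlConv hβ μ hhc).mono (sub t ht))
      have h2 := H t ht
      rw [e2 t ht, h1] at h2
      rw [e3 t ht, h2]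
      ring
    rw [e1 t ht]
    linarith

/-! ### Volterra equations with a small kernel -/

/-- The kernel `k (t - s) g s` takes values in `[0, 1 / (2a)]` for `0 ≤ s ≤ t ≤ a`, so its Volterra
operator is positive with norm at most `1 / 2` on `C([0, a])`. -/
structure IsHalfKernel (a : ℝ) (k g : ℝ → ℝ) : Prop where
  continuous_kernel : Continuous k
  continuous_weight : Continuous g
  nonneg : ∀ s t, 0 ≤ s → s ≤ t → t ≤ a → 0 ≤ k (t - s) * g s
  le : ∀ s t, 0 ≤ s → s ≤ t → t ≤ a → k (t - s) * g s ≤ 1 / (2 * a)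

namespace IsHalfKernel

variable {a : ℝ} {k g : ℝ → ℝ}

theorem intervalIntegrable (hk : IsHalfKernel a k g) {w : ℝ → ℝ} {t : ℝ}
    (ht : 0 ≤ t) (hw : ContinuousOn w (Set.Icc 0 t)) :
    IntervalIntegrable (fun s => k (t - s) * (g s * w s)) volume 0 t := by
  have h1 := hk.continuous_kernel
  have h2 := hk.continuous_weight
  exact ((by fun_prop : Continuous fun s => k (t - s)).continuousOn.mul
    (h2.continuousOn.mul hw)).intervalIntegrable_of_Icc ht

theorem abs_integral_le (hk : IsHalfKernel a k g) (ha : 0 < a) {w : ℝ → ℝ} {t M : ℝ}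
    (ht : t ∈ Set.Icc 0 a) (hM : ∀ s ∈ Set.Icc 0 t, |w s| ≤ M) :
    |∫ s in (0 : ℝ)..t, k (t - s) * (g s * w s)| ≤ M / 2 := by
  have hM0 : 0 ≤ M := (abs_nonneg _).trans (hM 0 ⟨le_rfl, ht.1⟩)
  have h1 := intervalIntegral.norm_integral_le_of_norm_le_const (a := 0) (b := t)
    (f := fun s => k (t - s) * (g s * w s)) (C := 1 / (2 * a) * M) fun s hs => by
      rw [Set.uIoc_of_le ht.1] at hs
      rw [← mul_assoc, norm_mul, Real.norm_of_nonneg (hk.nonneg s t hs.1.le hs.2 ht.2)]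
      exact mul_le_mul (hk.le s t hs.1.le hs.2 ht.2) (hM s ⟨hs.1.le, hs.2⟩) (norm_nonneg _)
        (by positivity)
  rw [Real.norm_eq_abs, sub_zero, abs_of_nonneg ht.1] at h1
  refine h1.trans ?_
  calc 1 / (2 * a) * M * t ≤ 1 / (2 * a) * M * a :=
        mul_le_mul_of_nonneg_left ht.2 (by positivity)
    _ = M / 2 := by field_simp

theorem unique (hk : IsHalfKernel a k g) (ha : 0 < a) {f w₁ w₂ : ℝ → ℝ}
    (h₁ : ContinuousOn w₁ (Set.Icc 0 a)) (h₂ : ContinuousOn w₂ (Set.Icc 0 a))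
    (H₁ : ∀ t ∈ Set.Icc 0 a, w₁ t = f t + ∫ s in (0 : ℝ)..t, k (t - s) * (g s * w₁ s))
    (H₂ : ∀ t ∈ Set.Icc 0 a, w₂ t = f t + ∫ s in (0 : ℝ)..t, k (t - s) * (g s * w₂ s))
    {t : ℝ} (ht : t ∈ Set.Icc 0 a) : w₁ t = w₂ t := by
  obtain ⟨t₀, ht₀, hmax⟩ := isCompact_Icc.exists_isMaxOn (Set.nonempty_Icc.2 ha.le)
    (h₁.sub h₂).abs
  have hmax' : ∀ s ∈ Set.Icc 0 a, |w₁ s - w₂ s| ≤ |w₁ t₀ - w₂ t₀| := fun s hs => hmax hs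
  have e : w₁ t₀ - w₂ t₀ = ∫ s in (0 : ℝ)..t₀, k (t₀ - s) * (g s * (w₁ s - w₂ s)) := by
    have hsub : Set.Icc 0 t₀ ⊆ Set.Icc 0 a := Set.Icc_subset_Icc_right ht₀.2
    rw [H₁ t₀ ht₀, H₂ t₀ ht₀, add_sub_add_left_eq_sub,
      ← intervalIntegral.integral_sub (hk.intervalIntegrable ht₀.1 (h₁.mono hsub))
        (hk.intervalIntegrable ht₀.1 (h₂.mono hsub))]
    exact intervalIntegral.integral_congr fun s _ => by ring
  have h := hk.abs_integral_le ha ht₀ (w := fun s => w₁ s - w₂ s) fun s hs =>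
    hmax' s ⟨hs.1, hs.2.trans ht₀.2⟩
  rw [← e] at h
  have h0 : |w₁ t₀ - w₂ t₀| ≤ 0 := by linarith
  have := hmax' t ht
  exact sub_eq_zero.1 (abs_nonpos_iff.1 (this.trans h0))

/-- A solution with nonnegative free term is nonnegative, hence dominates its free term. -/
theorem free_term_le (hk : IsHalfKernel a k g) (ha : 0 < a) {f w : ℝ → ℝ}
    (hw : ContinuousOn w (Set.Icc 0 a)) (hf : ∀ t ∈ Set.Icc 0 a, 0 ≤ f t)
    (H : ∀ t ∈ Set.Icc 0 a, w t = f t + ∫ s in (0 : ℝ)..t, k (t - s) * (g s * w s))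
    {t : ℝ} (ht : t ∈ Set.Icc 0 a) : f t ≤ w t := by
  obtain ⟨t₀, ht₀, hmin⟩ := isCompact_Icc.exists_isMinOn (Set.nonempty_Icc.2 ha.le) hw
  have hmin' : ∀ s ∈ Set.Icc 0 a, w t₀ ≤ w s := fun s hs => hmin hs
  have hsub : Set.Icc 0 t₀ ⊆ Set.Icc 0 a := Set.Icc_subset_Icc_right ht₀.2
  have h0 : 0 ≤ w t₀ := by
    by_contra! hneg
    have h1 := hk.abs_integral_le ha ht₀ (w := fun _ => w t₀) (M := -w t₀)
      fun s _ => (abs_of_neg hneg).le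
    have h2 : ∫ s in (0 : ℝ)..t₀, k (t₀ - s) * (g s * w t₀) ≤
        ∫ s in (0 : ℝ)..t₀, k (t₀ - s) * (g s * w s) := by
      refine intervalIntegral.integral_mono_on ht₀.1
        (hk.intervalIntegrable ht₀.1 continuousOn_const)
        (hk.intervalIntegrable ht₀.1 (hw.mono hsub)) fun s hs => ?_
      rw [← mul_assoc, ← mul_assoc]
      exact mul_le_mul_of_nonneg_left (hmin' s (hsub hs)) (hk.nonneg s t₀ hs.1 hs.2 ht₀.2)
    have h3 := H t₀ ht₀
    have h4 := hf t₀ ht₀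
    have h5 := (abs_le.1 h1).1
    linarith
  rw [H t ht, le_add_iff_nonneg_right]
  refine intervalIntegral.integral_nonneg ht.1 fun s hs => ?_
  rw [← mul_assoc]
  exact mul_nonneg (hk.nonneg s t hs.1 hs.2 ht.2) (h0.trans (hmin' s ⟨hs.1, hs.2.trans ht.2⟩))

theorem exists_solution (hk : IsHalfKernel a k g) (ha : 0 < a) {f : ℝ → ℝ} (hf : Continuous f) :
    ∃ w : ℝ → ℝ, Continuous w ∧
      ∀ t ∈ Set.Icc 0 a, w t = f t + ∫ s in (0 : ℝ)..t, k (t - s) * (g s * w s) := by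
  have h1 := hk.continuous_kernel
  have h2 := hk.continuous_weight
  have hcont : ∀ w : C(Set.Icc (0 : ℝ) a, ℝ), Continuous fun t =>
      f t + ∫ s in (0 : ℝ)..t, k (t - s) * (g s * Set.IccExtend ha.le w s) := fun w => by
    have h3 : Continuous (Set.IccExtend ha.le w) := w.continuous.Icc_extend'
    exact hf.add (intervalIntegral.continuous_parametric_intervalIntegral_of_continuous
      (f := fun t s => k (t - s) * (g s * Set.IccExtend ha.le w s)) (by fun_prop) continuous_id)
  set Φ : C(Set.Icc (0 : ℝ) a, ℝ) → C(Set.Icc (0 : ℝ) a, ℝ) := fun w =>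
    ⟨fun t => f t + ∫ s in (0 : ℝ)..t, k (t - s) * (g s * Set.IccExtend ha.le w s),
      (hcont w).comp continuous_subtype_val⟩ with hΦ
  have hlip : ContractingWith (1 / 2) Φ := by
    refine ⟨by rw [← NNReal.coe_lt_coe]; norm_num, LipschitzWith.of_dist_le_mul fun w₁ w₂ => ?_⟩
    rw [ContinuousMap.dist_le (by positivity)]
    intro t
    have c₁ : Continuous (Set.IccExtend ha.le w₁) := w₁.continuous.Icc_extend'
    have c₂ : Continuous (Set.IccExtend ha.le w₂) := w₂.continuous.Icc_extend'
    have e : Φ w₁ t - Φ w₂ t = ∫ s in (0 : ℝ)..t, k (t - s) *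
        (g s * (Set.IccExtend ha.le w₁ s - Set.IccExtend ha.le w₂ s)) := by
      simp only [hΦ, ContinuousMap.coe_mk]
      rw [add_sub_add_left_eq_sub,
        ← intervalIntegral.integral_sub (hk.intervalIntegrable t.2.1 c₁.continuousOn)
          (hk.intervalIntegrable t.2.1 c₂.continuousOn)]
      exact intervalIntegral.integral_congr fun s _ => by ring
    rw [Real.dist_eq, e]
    refine (hk.abs_integral_le ha t.2 (M := dist w₁ w₂) fun s _ => ?_).trans ?_
    · rw [← Real.dist_eq]
      exact ContinuousMap.dist_apply_le_dist (f := w₁) (g := w₂) (Set.projIcc 0 a ha.le s)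
    · simp; linarith
  set w : C(Set.Icc (0 : ℝ) a, ℝ) := ContractingWith.fixedPoint Φ hlip
  refine ⟨Set.IccExtend ha.le w, w.continuous.Icc_extend', fun t ht => ?_⟩
  have h := DFunLike.congr_fun hlip.fixedPoint_isFixedPt ⟨t, ht⟩
  rw [Set.IccExtend_of_mem ha.le _ ht]
  exact h.symm

end IsHalfKernel

/-! ### The scalar Caputo equation -/

/-- A solution of the integral equation `w = c + I^β (q w)` with smooth `q` solves the Caputo
equation classically. Its second derivative has the singularity `t ^ (β - 2)` at the origin. -/
theorem exists_deriv_of_eq_fracInt {β a c : ℝ} (hβ : 1 < β) (hβ2 : β < 2) (ha : 0 ≤ a)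
    {w q q' : ℝ → ℝ} (hw : ContinuousOn w (Set.Icc 0 a)) (hq : ∀ t, HasDerivAt q (q' t) t)
    (hq' : Continuous q')
    (H : ∀ t ∈ Set.Icc 0 a, w t = c + fracInt β (fun s => q s * w s) t) :
    ∃ w₁ w₂ : ℝ → ℝ,
      (∀ t ∈ Set.Icc 0 a, HasDerivWithinAt w (w₁ t) (Set.Icc 0 a) t) ∧
      ContinuousOn w₁ (Set.Icc 0 a) ∧ w₁ 0 = 0 ∧
      (∀ t ∈ Set.Ioo 0 a, HasDerivAt w₁ (w₂ t) t) ∧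
      IntervalIntegrable w₂ volume 0 a ∧
      ∀ t ∈ Set.Ioo 0 a,
        IntervalIntegrable (fun s => rlKernel (2 - β) (t - s) * w₂ s) volume 0 t ∧
        fracInt (2 - β) w₂ t = q t * w t := by
  have hqc : Continuous q := continuous_iff_continuousAt.2 fun t => (hq t).continuousAt
  set h : ℝ → ℝ := fun s => q s * w s with hh
  have hhc : ContinuousOn h (Set.Icc 0 a) := hqc.continuousOn.mul hw
  set w₁ : ℝ → ℝ := fracInt (β - 1) h with hw₁
  have hd : ∀ t ∈ Set.Icc 0 a, HasDerivWithinAt w (w₁ t) (Set.Icc 0 a) t := fun t ht => by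
    have := (hasDerivWithinAt_fracInt_add_one (by linarith : 0 < β - 1) ha hhc ht).const_add c
    rw [sub_add_cancel] at this
    exact this.congr_of_mem H ht
  have hw₁c : ContinuousOn w₁ (Set.Icc 0 a) := continuousOn_fracInt (by linarith) hhc
  set h' : ℝ → ℝ := fun t => q' t * w t + q t * w₁ t with hh'
  have hh'c : ContinuousOn h' (Set.Icc 0 a) :=
    (hq'.continuousOn.mul hw).add (hqc.continuousOn.mul hw₁c)
  have hhd : ∀ t ∈ Set.Icc 0 a, HasDerivWithinAt h (h' t) (Set.Icc 0 a) t := fun t ht =>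
    (hq t).hasDerivWithinAt.mul (hd t ht)
  set w₂ : ℝ → ℝ := fun t => h 0 * rlKernel (β - 1) t + fracInt (β - 1) h' t with hw₂
  have hfc : ContinuousOn (fracInt (β - 1) h') (Set.Icc 0 a) :=
    continuousOn_fracInt (by linarith) hh'c
  refine ⟨w₁, w₂, hd, hw₁c, by simp [hw₁, fracInt], fun t ht => ?_, ?_, fun t ht => ?_⟩
  · have htI : Set.Icc 0 a ∈ 𝓝 t := Icc_mem_nhds ht.1 ht.2
    have e : w₁ =ᶠ[𝓝 t] fun t => h 0 * rlKernel β t + fracInt β h' t := by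
      filter_upwards [htI] with s hs
      have := fracInt_eq_add_fracInt_deriv (by linarith : 0 < β - 1) hhd hh'c hs
      rwa [sub_add_cancel] at this
    refine HasDerivAt.congr_of_eventuallyEq (HasDerivAt.add (HasDerivAt.const_mul _ ?_) ?_) e
    · have h1 := (Real.hasDerivAt_rpow_const (x := t) (p := β - 1) (Or.inl ht.1.ne')).div_const
        (Real.Gamma β)
      refine h1.congr_deriv ?_
      have h2 := Real.Gamma_add_one (by linarith : β - 1 ≠ 0)
      rw [sub_add_cancel] at h2
      have h3 : β - 1 ≠ 0 := by linarith
      rw [rlKernel, h2, mul_div_mul_left _ _ h3]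
    · have h1 := (hasDerivWithinAt_fracInt_add_one (by linarith : 0 < β - 1) ha hh'c
        ⟨ht.1.le, ht.2.le⟩).hasDerivAt htI
      rwa [sub_add_cancel] at h1
  · exact ((intervalIntegrable_rlKernel (by linarith) a).const_mul _).add
      (hfc.intervalIntegrable_of_Icc ha)
  · have hsub : Set.Icc 0 t ⊆ Set.Icc 0 a := Set.Icc_subset_Icc_right ht.2.le
    have i1 : IntervalIntegrable (fun s => rlKernel (2 - β) (t - s) * (h 0 * rlKernel (β - 1) s))
        volume 0 t := by
      refine ((intervalIntegrable_rlKernel_mul_rlKernel (by linarith : 0 < 2 - β)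
        (by linarith : 0 < β - 1) ht.1).const_mul (h 0)).congr fun s _ => by ring
    have i2 : IntervalIntegrable (fun s => rlKernel (2 - β) (t - s) * fracInt (β - 1) h' s)
        volume 0 t :=
      intervalIntegrable_rlKernel_sub_mul (by linarith) ht.1.le (hfc.mono hsub)
    refine ⟨(i1.add i2).congr fun s _ => by simp only [hw₂]; ring, ?_⟩
    rw [hw₂, fracInt_add i1 i2, fracInt_const_mul,
      fracInt_rlKernel (by linarith) (by linarith) ht.1,
      fracInt_fracInt (by linarith) (by linarith) (by linarith) ht.1.le
        ((hh'c.mono hsub).intervalIntegrable_of_Icc ht.1.le), show 2 - β + (β - 1) = 1 by ring,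
      rlKernel_one, fracInt_one,
      intervalIntegral.integral_eq_sub_of_hasDerivAt_of_le ht.1.le (hhc.mono hsub)
        (fun x hx => (hhd x ⟨hx.1.le, hx.2.le.trans ht.2.le⟩).hasDerivAt
          (Icc_mem_nhds hx.1 (hx.2.trans ht.2)))
        ((hh'c.mono hsub).intervalIntegrable_of_Icc ht.1.le)]
    ring

/-- A classical solution of a Caputo equation with zero initial velocity solves the corresponding
integral equation. -/
theorem eq_fracInt_of_caputo {β a : ℝ} (hβ : 1 < β) (hβ2 : β < 2) {y y₁ y₂ h : ℝ → ℝ}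
    (hy : ∀ t ∈ Set.Icc 0 a, HasDerivWithinAt y (y₁ t) (Set.Icc 0 a) t)
    (hy₁ : ContinuousOn y₁ (Set.Icc 0 a)) (hy0 : y₁ 0 = 0)
    (hy₂ : ∀ t ∈ Set.Ioo 0 a, HasDerivAt y₁ (y₂ t) t)
    (hi : IntervalIntegrable y₂ volume 0 a) (hh : ContinuousOn h (Set.Icc 0 a))
    (H : ∀ t ∈ Set.Ioo 0 a, fracInt (2 - β) y₂ t = h t) {t : ℝ} (ht : t ∈ Set.Icc 0 a) :
    y t = y 0 + fracInt β h t := by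
  have e1 : ∀ t ∈ Set.Icc 0 a, y₁ t = fracInt (β - 1) h t := fun t ht => by
    have hsub : Set.Icc 0 t ⊆ Set.Icc 0 a := Set.Icc_subset_Icc_right ht.2
    have hit : IntervalIntegrable y₂ volume 0 t := hi.mono_set (by
      rw [Set.uIcc_of_le ht.1, Set.uIcc_of_le (ht.1.trans ht.2)]; exact hsub)
    have h1 := intervalIntegral.integral_eq_sub_of_hasDerivAt_of_le ht.1 (hy₁.mono hsub)
      (fun x hx => hy₂ x ⟨hx.1, hx.2.trans_le ht.2⟩) hit
    rw [hy0, sub_zero, ← fracInt_one, show (1 : ℝ) = (β - 1) + (2 - β) by ring,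
      ← fracInt_fracInt (by linarith) (by linarith) (by linarith) ht.1 hit] at h1
    rw [← h1]
    exact fracInt_congr_Ioo ht.1 fun s hs => H s ⟨hs.1, hs.2.trans_le ht.2⟩
  have hsub : Set.Icc 0 t ⊆ Set.Icc 0 a := Set.Icc_subset_Icc_right ht.2
  have h1 := intervalIntegral.integral_eq_sub_of_hasDerivAt_of_le ht.1
    (f := y) (f' := y₁) (fun x hx => ((hy x (hsub hx)).continuousWithinAt).mono hsub)
    (fun x hx => (hy x ⟨hx.1.le, hx.2.le.trans ht.2⟩).hasDerivAt
      (Icc_mem_nhds hx.1 (hx.2.trans_le ht.2))) ((hy₁.mono hsub).intervalIntegrable_of_Icc ht.1)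
  rw [← fracInt_one, fracInt_congr ht.1 fun s hs => e1 s (hsub hs),
    fracInt_fracInt one_pos (by linarith) (by linarith) ht.1
      ((hh.mono hsub).intervalIntegrable_of_Icc ht.1), show 1 + (β - 1) = β by ring] at h1
  linarith

/-! ### The Dirichlet sine basis of `L²(0, π)` -/

theorem eigenvalue_pos (p : ℕ+) : 0 < eigenvalue p := by
  have : 0 < ((p : ℕ) : ℝ) := by exact_mod_cast p.pos
  exact pow_pos this 2

theorem intervalIntegrable_coe (v : L2) : IntervalIntegrable v volume 0 Real.pi := by
  rw [intervalIntegrable_iff_integrableOn_Ioo_of_le Real.pi_pos.le]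
  exact (Lp.memLp v).integrable (by norm_num)

theorem inner_eigenfun (v : L2) (p : ℕ+) :
    inner ℝ v (eigenfun p) =
      √(2 / Real.pi) * ∫ y in (0 : ℝ)..Real.pi, Real.sin (((p : ℕ) : ℝ) * y) * v y := by
  rw [L2.inner_def, intervalIntegral.integral_of_le Real.pi_pos.le, integral_Ioc_eq_integral_Ioo,
    ← integral_const_mul]
  refine integral_congr_ae ?_
  filter_upwards [(memLp_eigenfun p).coeFn_toLp] with y hy
  rw [eigenfun, hy, RCLike.inner_apply, conj_trivial, mul_assoc]

theorem integral_cos_intCast_mul (m : ℤ) :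
    ∫ y in (0 : ℝ)..Real.pi, Real.cos (m * y) = if m = 0 then Real.pi else 0 := by
  split_ifs with h
  · simp [h]
  · have : (m : ℝ) ≠ 0 := by exact_mod_cast h
    rw [intervalIntegral.integral_comp_mul_left _ this, integral_cos]
    simp [Real.sin_int_mul_pi]

theorem orthonormal_eigenfun : Orthonormal ℝ eigenfun := by
  rw [orthonormal_iff_ite]
  intro p q
  have h1 : ∫ y in (0 : ℝ)..Real.pi, Real.sin (((q : ℕ) : ℝ) * y) * eigenfun p y =
      √(2 / Real.pi) * ((1 / 2) * ((∫ y in (0 : ℝ)..Real.pi, Real.cos (((p - q : ℤ) : ℝ) * y)) -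
        ∫ y in (0 : ℝ)..Real.pi, Real.cos (((p + q : ℤ) : ℝ) * y))) := by
    rw [← intervalIntegral.integral_sub (Continuous.intervalIntegrable (by fun_prop) _ _)
      (Continuous.intervalIntegrable (by fun_prop) _ _), ← intervalIntegral.integral_const_mul,
      ← intervalIntegral.integral_const_mul]
    rw [intervalIntegral.integral_of_le Real.pi_pos.le, intervalIntegral.integral_of_le
      Real.pi_pos.le, integral_Ioc_eq_integral_Ioo, integral_Ioc_eq_integral_Ioo]
    refine integral_congr_ae ?_
    filter_upwards [(memLp_eigenfun p).coeFn_toLp] with y hy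
    rw [eigenfun, hy]
    push_cast
    rw [sub_mul, add_mul, Real.cos_sub, Real.cos_add]
    ring
  rw [inner_eigenfun, h1, integral_cos_intCast_mul, integral_cos_intCast_mul,
    if_neg (show ¬ ((p : ℕ) : ℤ) + (q : ℕ) = 0 by have := p.pos; omega), ← mul_assoc,
    Real.mul_self_sqrt (by positivity)]
  have := Real.pi_pos.ne'
  by_cases h : p = q
  · simp only [h, sub_self, if_true, sub_zero]
    field_simp
  · have h2 : ¬ (((p : ℕ) : ℤ) - (q : ℕ) = 0) := fun h' => h (PNat.coe_injective (by omega))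
    rw [if_neg h, if_neg h2]
    ring

/-- Completeness of the sine system: the odd extension of an orthogonal function has vanishing
Fourier coefficients on `(-π, π)`. -/
theorem eq_zero_of_inner_eigenfun_eq_zero {v : L2} (hv : ∀ p : ℕ+, inner ℝ v (eigenfun p) = 0) :
    v = 0 := by
  have hpi := Real.pi_pos
  have hsin : ∀ n : ℤ, ∫ y in (0 : ℝ)..Real.pi, Real.sin (n * y) * v y = 0 := by
    have hnat : ∀ p : ℕ+, ∫ y in (0 : ℝ)..Real.pi, Real.sin (((p : ℕ) : ℝ) * y) * v y = 0 :=
      fun p => by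
        have h := hv p
        rw [inner_eigenfun] at h
        exact (mul_eq_zero.1 h).resolve_left (by positivity)
    intro n
    rcases lt_trichotomy n 0 with h | rfl | h
    · have h1 := hnat ⟨n.natAbs, by omega⟩
      have h2 : ((n.natAbs : ℕ) : ℝ) = -n := by
        rw [Nat.cast_natAbs, abs_of_neg h]; push_cast; rfl
      simp only [PNat.mk_coe, h2, neg_mul, Real.sin_neg, intervalIntegral.integral_neg] at h1
      exact neg_eq_zero.1 h1
    · simp
    · have h1 := hnat ⟨n.natAbs, by omega⟩
      have h2 : ((n.natAbs : ℕ) : ℝ) = n := by rw [Nat.cast_natAbs, abs_of_pos h]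
      simpa only [PNat.mk_coe, h2] using h1
  set V : ℝ → ℝ := (Set.Ioo 0 Real.pi).indicator v with hV
  have hVm : MemLp V 2 volume := (memLp_indicator_iff_restrict measurableSet_Ioo).2 (Lp.memLp v)
  have hVneg : MemLp (fun x => V (-x)) 2 volume :=
    hVm.comp_measurePreserving (Measure.measurePreserving_neg volume)
  set f : ℝ → ℂ := fun x => ((V x - V (-x) : ℝ) : ℂ) with hf
  have hfm : MemLp f 2 (volume.restrict (Set.Ioc (-Real.pi) Real.pi)) :=
    ((hVm.sub hVneg).restrict _).ofReal
  have hVi : IntervalIntegrable V volume (-Real.pi) Real.pi := by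
    rw [intervalIntegrable_iff_integrableOn_Ioc_of_le (by linarith)]
    exact (hVm.restrict _).integrable (by norm_num)
  have hofReal : ∀ {g : ℝ → ℝ}, IntervalIntegrable g volume (-Real.pi) Real.pi →
      IntervalIntegrable (fun x => (g x : ℂ)) volume (-Real.pi) Real.pi := fun h =>
    ⟨h.1.ofReal, h.2.ofReal⟩
  have hVi' : IntervalIntegrable (fun x => V (-x)) volume (-Real.pi) Real.pi := by
    rw [intervalIntegrable_iff_integrableOn_Ioc_of_le (by linarith)]
    exact (hVneg.restrict _).integrable (by norm_num)
  have hcoef : ∀ n : ℤ, fourierCoeffOn (neg_lt_self hpi) f n = 0 := by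
    intro n
    set e : ℝ → ℂ := fun x => Complex.exp (-((n * x : ℝ) : ℂ) * Complex.I) with he
    have hec : Continuous e := by fun_prop
    rw [fourierCoeffOn_eq_integral]
    have h1 : ∀ x : ℝ, fourier (-n) (x : AddCircle (Real.pi - -Real.pi)) • f x =
        e x * (V x : ℂ) - e x * (V (-x) : ℂ) := fun x => by
      rw [fourier_coe_apply, smul_eq_mul, hf, he]
      have : (2 * Real.pi * Complex.I * ((-n : ℤ) : ℂ) * x / ((Real.pi - -Real.pi : ℝ) : ℂ)) =
          -((n * x : ℝ) : ℂ) * Complex.I := by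
        have : (Real.pi : ℂ) ≠ 0 := by exact_mod_cast hpi.ne'
        push_cast
        field_simp
        ring
      rw [this]
      push_cast
      ring
    have i1 : IntervalIntegrable (fun x => e x * (V x : ℂ)) volume (-Real.pi) Real.pi :=
      (hofReal hVi).continuousOn_mul hec.continuousOn
    have i2 : IntervalIntegrable (fun x => e x * (V (-x) : ℂ)) volume (-Real.pi) Real.pi :=
      (hofReal hVi').continuousOn_mul hec.continuousOn
    have i3 : IntervalIntegrable (fun x => e (-x) * (V x : ℂ)) volume (-Real.pi) Real.pi :=
      (hofReal hVi).continuousOn_mul (hec.comp continuous_neg).continuousOn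
    have h2 : ∫ x in (-Real.pi)..Real.pi, e x * (V (-x) : ℂ) =
        ∫ x in (-Real.pi)..Real.pi, e (-x) * (V x : ℂ) := by
      have := intervalIntegral.integral_comp_neg (a := -Real.pi) (b := Real.pi)
        (fun x => e (-x) * (V x : ℂ))
      simpa using this
    have h3 : ∀ x : ℝ, e x * (V x : ℂ) - e (-x) * (V x : ℂ) =
        (-2 * Complex.I) * ((Real.sin (n * x) * V x : ℝ) : ℂ) := fun x => by
      simp only [he]
      rw [Complex.exp_mul_I, Complex.exp_mul_I]
      push_cast
      simp only [mul_neg, neg_neg, Complex.cos_neg, Complex.sin_neg]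
      ring
    have h4 : ∫ x in (-Real.pi)..Real.pi, Real.sin (n * x) * V x = 0 := by
      rw [← hsin n, intervalIntegral.integral_of_le (by linarith),
        intervalIntegral.integral_of_le hpi.le, integral_Ioc_eq_integral_Ioo (x := 0)]
      have : ∀ x, Real.sin (n * x) * V x =
          (Set.Ioo 0 Real.pi).indicator (fun x => Real.sin (n * x) * v x) x := fun x => by
        rw [hV, Set.indicator_mul_right]
      simp only [this]
      rw [setIntegral_indicator measurableSet_Ioo, Set.inter_eq_right.2]
      exact fun x hx => ⟨by linarith [hx.1], hx.2.le⟩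
    simp only [h1]
    rw [intervalIntegral.integral_sub i1 i2, h2, ← intervalIntegral.integral_sub i1 i3]
    simp only [h3]
    rw [intervalIntegral.integral_const_mul, intervalIntegral.integral_ofReal, h4]
    simp
  have hP := hasSum_sq_fourierCoeffOn (neg_lt_self hpi) hfm
  simp only [hcoef, norm_zero, ne_eq, OfNat.ofNat_ne_zero, not_false_eq_true, zero_pow] at hP
  have h0 : ∫ x in (-Real.pi)..Real.pi, ‖f x‖ ^ 2 = 0 := by
    have := hP.unique hasSum_zero
    rw [smul_eq_mul, mul_eq_zero] at this
    exact this.resolve_left (inv_ne_zero (by linarith))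
  rw [intervalIntegral.integral_of_le (by linarith), integral_eq_zero_iff_of_nonneg
    (fun _ => by positivity) hfm.integrable_norm_pow'] at h0
  have h5 := ae_restrict_of_ae_restrict_of_subset
    (show Set.Ioo 0 Real.pi ⊆ Set.Ioc (-Real.pi) Real.pi from
      fun x hx => ⟨by linarith [hx.1], hx.2.le⟩) h0
  refine (Lp.eq_zero_iff_ae_eq_zero).2 ?_
  filter_upwards [h5, ae_restrict_mem measurableSet_Ioo] with x hx hxm
  have hx0 : ¬ (0 < -x) := by linarith [hxm.1]
  have hf0 : f x = 0 := by simpa using hx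
  simpa [hf, hV, Set.indicator, hxm.1, hxm.2, hx0, not_lt.2 hxm.1.le] using hf0

/-- The Dirichlet eigenfunctions as a Hilbert basis. -/
def sineBasis : HilbertBasis ℕ+ ℝ L2 :=
  HilbertBasis.mkOfOrthogonalEqBot orthonormal_eigenfun (by
    refine (Submodule.eq_bot_iff _).2 fun v hv => eq_zero_of_inner_eigenfun_eq_zero fun p => ?_
    exact (Submodule.mem_orthogonal' _ _).1 hv _ (Submodule.subset_span ⟨p, rfl⟩))

theorem coe_sineBasis : ⇑sineBasis = eigenfun := HilbertBasis.coe_mkOfOrthogonalEqBot _ _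

theorem hasSum_inner_smul_eigenfun (v : L2) :
    HasSum (fun p => inner ℝ v (eigenfun p) • eigenfun p) v := by
  have := sineBasis.hasSum_repr v
  simpa only [sineBasis.repr_apply_apply, coe_sineBasis, real_inner_comm] using this

theorem eq_of_inner_eigenfun_eq {v w : L2}
    (h : ∀ p, inner ℝ v (eigenfun p) = inner ℝ w (eigenfun p)) : v = w :=
  sub_eq_zero.1 (eq_zero_of_inner_eigenfun_eq_zero fun p => by rw [inner_sub_left, h p, sub_self])

theorem inner_of_hasSum {c : ℕ+ → ℝ} {v : L2} (h : HasSum (fun p => c p • eigenfun p) v) (p : ℕ+) :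
    inner ℝ v (eigenfun p) = c p := by
  have h1 := h.mapL (innerSL ℝ (eigenfun p))
  have h2 : (fun q => innerSL ℝ (eigenfun p) (c q • eigenfun q)) =
      fun q => if q = p then c p else 0 := by
    ext q
    rw [innerSL_apply_apply, inner_smul_right, orthonormal_iff_ite.1 orthonormal_eigenfun]
    by_cases hq : q = p
    · simp [hq]
    · simp [hq, Ne.symm hq]
  rw [h2] at h1
  rw [real_inner_comm]
  exact h1.unique (hasSum_ite_eq p (c p))

theorem inner_finset_sum_eigenfun (s : Finset ℕ+) (c : ℕ+ → ℝ) (p : ℕ+) :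
    inner ℝ (∑ q ∈ s, c q • eigenfun q) (eigenfun p) = if p ∈ s then c p else 0 := by
  rw [sum_inner]
  simp only [inner_smul_left, orthonormal_iff_ite.1 orthonormal_eigenfun]
  simp

theorem abs_inner_eigenfun_le (v : L2) (p : ℕ+) : |inner ℝ v (eigenfun p)| ≤ ‖v‖ := by
  have := abs_real_inner_le_norm v (eigenfun p)
  rwa [orthonormal_eigenfun.1 p, mul_one] at this

theorem norm_sq_finset_sum_eigenfun (s : Finset ℕ+) (c : ℕ+ → ℝ) :
    ‖∑ q ∈ s, c q • eigenfun q‖ ^ 2 = ∑ q ∈ s, c q ^ 2 := by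
  rw [← real_inner_self_eq_norm_sq, orthonormal_eigenfun.inner_sum]
  simp [sq]

theorem summable_smul_eigenfun {c : ℕ+ → ℝ} (hc : Summable fun p => c p ^ 2) :
    Summable fun p => c p • eigenfun p := by
  have h := (orthonormal_eigenfun.orthogonalFamily.summable_iff_norm_sq_summable c).2
    (by simpa using hc)
  simpa using h

/-! ### The Dirichlet Laplacian -/

theorem inner_eigenfun_of_isNegLaplacian {v w : L2} (h : IsNegLaplacian v w) (p : ℕ+) :
    inner ℝ w (eigenfun p) = eigenvalue p * inner ℝ v (eigenfun p) := by
  obtain ⟨f, g, hvf, hf0, hfpi, hfg, hgw⟩ := h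
  have hpi := Real.pi_pos
  set r : ℝ := ((p : ℕ) : ℝ) with hr
  have hwi := intervalIntegrable_coe w
  set W : ℝ → ℝ := fun y => ∫ z in (0 : ℝ)..y, w z with hW
  have hWac : AbsolutelyContinuousOnInterval W 0 Real.pi :=
    hwi.absolutelyContinuousOnInterval_intervalIntegral Set.left_mem_uIcc
  have hφac : AbsolutelyContinuousOnInterval (fun y => Real.sin (r * y)) 0 Real.pi :=
    ContDiffOn.absolutelyContinuousOnInterval (by fun_prop)
  have hφd : ∀ y, HasDerivAt (fun y => Real.sin (r * y)) (r * Real.cos (r * y)) y := fun y => by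
    simpa [mul_comm] using ((hasDerivAt_id y).const_mul r).sin
  have hφdd : ∀ y, HasDerivAt (fun y => r * Real.cos (r * y)) (-(r ^ 2 * Real.sin (r * y))) y :=
    fun y => by
      have := (((hasDerivAt_id y).const_mul r).cos).const_mul r
      simp only [id, mul_one] at this
      exact this.congr_deriv (by ring)
  have hsinpi : Real.sin (r * Real.pi) = 0 := Real.sin_nat_mul_pi _
  have hgc : ContinuousOn g (Set.Icc 0 Real.pi) := by
    have := hWac.continuousOn
    rw [Set.uIcc_of_le hpi.le] at this
    exact (continuousOn_const.sub this).congr hgw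
  -- integration by parts against the absolutely continuous derivative of `v`
  have e1 : ∫ y in (0 : ℝ)..Real.pi, Real.sin (r * y) * w y =
      -∫ y in (0 : ℝ)..Real.pi, r * Real.cos (r * y) * W y := by
    have h1 := hφac.integral_mul_deriv_eq_deriv_mul hWac
    rw [hsinpi, mul_zero, Real.sin_zero, zero_mul, zero_mul, sub_zero, zero_sub] at h1
    simp only [(hφd _).deriv] at h1
    rw [← h1]
    refine intervalIntegral.integral_congr_ae ?_
    filter_upwards [hwi.ae_hasDerivAt_integral] with y hy hym
    rw [(hy (Set.uIoc_subset_uIcc hym) 0 Set.left_mem_uIcc).deriv]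
  have hcosc : Continuous fun y => r * Real.cos (r * y) := by fun_prop
  have e2 : ∫ y in (0 : ℝ)..Real.pi, r * Real.cos (r * y) = 0 := by
    rw [intervalIntegral.integral_eq_sub_of_hasDerivAt (fun y _ => hφd y)
      (hcosc.intervalIntegrable _ _), hsinpi, mul_zero, Real.sin_zero, sub_zero]
  have e3 : -∫ y in (0 : ℝ)..Real.pi, r * Real.cos (r * y) * W y =
      ∫ y in (0 : ℝ)..Real.pi, r * Real.cos (r * y) * g y := by
    have : ∫ y in (0 : ℝ)..Real.pi, r * Real.cos (r * y) * g y =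
        ∫ y in (0 : ℝ)..Real.pi, (g 0 * (r * Real.cos (r * y)) - r * Real.cos (r * y) * W y) := by
      refine intervalIntegral.integral_congr fun y hy => ?_
      rw [Set.uIcc_of_le hpi.le] at hy
      simp only [hgw y hy]
      ring
    have hi : IntervalIntegrable (fun y => r * Real.cos (r * y) * W y) volume 0 Real.pi :=
      (hcosc.continuousOn.mul hWac.continuousOn).intervalIntegrable
    rw [this, intervalIntegral.integral_sub ((hcosc.const_mul _).intervalIntegrable _ _) hi,
      intervalIntegral.integral_const_mul, e2]
    ring
  have e4 : ∫ y in (0 : ℝ)..Real.pi, r * Real.cos (r * y) * g y =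
      r ^ 2 * ∫ y in (0 : ℝ)..Real.pi, Real.sin (r * y) * f y := by
    rw [intervalIntegral.integral_mul_deriv_eq_deriv_mul_of_hasDerivWithinAt (v := f)
      (fun y _ => (hφdd y).hasDerivWithinAt) (by rwa [Set.uIcc_of_le hpi.le])
      (Continuous.intervalIntegrable (by fun_prop) _ _) (hgc.intervalIntegrable_of_Icc hpi.le),
      hf0, hfpi, ← intervalIntegral.integral_const_mul, mul_zero, mul_zero, sub_zero, zero_sub,
      ← intervalIntegral.integral_neg]
    exact intervalIntegral.integral_congr fun y _ => by ring
  have e5 : ∫ y in (0 : ℝ)..Real.pi, Real.sin (r * y) * v y =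
      ∫ y in (0 : ℝ)..Real.pi, Real.sin (r * y) * f y := by
    rw [intervalIntegral.integral_of_le hpi.le, intervalIntegral.integral_of_le hpi.le,
      integral_Ioc_eq_integral_Ioo, integral_Ioc_eq_integral_Ioo]
    refine integral_congr_ae ?_
    filter_upwards [hvf] with y hy
    rw [hy]
  rw [inner_eigenfun, inner_eigenfun, e1, e3, e4, ← e5, eigenvalue]
  ring

theorem IsNegLaplacian.zero : IsNegLaplacian 0 0 := by
  refine ⟨0, 0, Lp.coeFn_zero ℝ 2 _, rfl, rfl, fun y _ => hasDerivWithinAt_const _ _ _,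
    fun y hy => ?_⟩
  have : ∫ z in (0 : ℝ)..y, (0 : L2) z = ∫ z in (0 : ℝ)..y, (0 : ℝ) := by
    rw [intervalIntegral.integral_of_le hy.1, intervalIntegral.integral_of_le hy.1,
      integral_Ioc_eq_integral_Ioo, integral_Ioc_eq_integral_Ioo]
    exact integral_congr_ae (ae_restrict_of_ae_restrict_of_subset
      (Set.Ioo_subset_Ioo_right hy.2) (Lp.coeFn_zero ℝ 2 _))
  rw [this]
  simp

theorem IsNegLaplacian.add {v₁ v₂ w₁ w₂ : L2} (h₁ : IsNegLaplacian v₁ w₁)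
    (h₂ : IsNegLaplacian v₂ w₂) : IsNegLaplacian (v₁ + v₂) (w₁ + w₂) := by
  obtain ⟨f₁, g₁, a₁, b₁, c₁, d₁, e₁⟩ := h₁
  obtain ⟨f₂, g₂, a₂, b₂, c₂, d₂, e₂⟩ := h₂
  refine ⟨fun y => f₁ y + f₂ y, fun y => g₁ y + g₂ y, ?_, by simp [b₁, b₂], by simp [c₁, c₂],
    fun y hy => (d₁ y hy).add (d₂ y hy), fun y hy => ?_⟩
  · filter_upwards [a₁, a₂, Lp.coeFn_add v₁ v₂] with y h1 h2 h3
    rw [h3, Pi.add_apply, h1, h2]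
  · have hi : ∀ w : L2, IntervalIntegrable w volume 0 y := fun w =>
      (intervalIntegrable_coe w).mono_set (by
        rw [Set.uIcc_of_le hy.1, Set.uIcc_of_le Real.pi_pos.le]
        exact Set.Icc_subset_Icc_right hy.2)
    have : ∫ z in (0 : ℝ)..y, (w₁ + w₂ : L2) z = ∫ z in (0 : ℝ)..y, (w₁ z + w₂ z) := by
      rw [intervalIntegral.integral_of_le hy.1, intervalIntegral.integral_of_le hy.1,
        integral_Ioc_eq_integral_Ioo, integral_Ioc_eq_integral_Ioo]
      exact integral_congr_ae (ae_restrict_of_ae_restrict_of_subset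
        (Set.Ioo_subset_Ioo_right hy.2) (Lp.coeFn_add w₁ w₂))
    rw [this, intervalIntegral.integral_add (hi w₁) (hi w₂)]
    simp only [e₁ y hy, e₂ y hy]
    ring

theorem isNegLaplacian_smul_eigenfun (c : ℝ) (p : ℕ+) :
    IsNegLaplacian (c • eigenfun p) ((eigenvalue p * c) • eigenfun p) := by
  set r : ℝ := ((p : ℕ) : ℝ) with hr
  set b : ℝ := √(2 / Real.pi) with hb
  have hsmul : ∀ c : ℝ, ∀ᵐ y ∂(volume.restrict (Set.Ioo (0 : ℝ) Real.pi)),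
      (c • eigenfun p) y = c * (b * Real.sin (r * y)) := fun c => by
    filter_upwards [(memLp_eigenfun p).coeFn_toLp, Lp.coeFn_smul c (eigenfun p)] with y h1 h2
    rw [h2, Pi.smul_apply, eigenfun, h1, smul_eq_mul]
  have hcos : ∀ y, HasDerivAt (fun y => c * (b * (r * Real.cos (r * y))))
      (-(eigenvalue p * c * (b * Real.sin (r * y)))) y := fun y => by
    have := (((((hasDerivAt_id y).const_mul r).cos).const_mul r).const_mul b).const_mul c
    simp only [id, mul_one] at this
    exact this.congr_deriv (by rw [eigenvalue]; ring)
  refine ⟨fun y => c * (b * Real.sin (r * y)), fun y => c * (b * (r * Real.cos (r * y))), hsmul c,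
    by simp, ?_, fun y _ => ?_, fun y hy => ?_⟩
  · have : Real.sin (r * Real.pi) = 0 := Real.sin_nat_mul_pi _
    simp [this]
  · have := ((((hasDerivAt_id y).const_mul r).sin).const_mul b).const_mul c
    simp only [id, mul_one] at this
    exact (this.congr_deriv (by ring)).hasDerivWithinAt
  · have h1 : ∫ z in (0 : ℝ)..y, ((eigenvalue p * c) • eigenfun p) z =
        ∫ z in (0 : ℝ)..y, -(-(eigenvalue p * c * (b * Real.sin (r * z)))) := by
      rw [intervalIntegral.integral_of_le hy.1, intervalIntegral.integral_of_le hy.1,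
        integral_Ioc_eq_integral_Ioo, integral_Ioc_eq_integral_Ioo]
      simp only [neg_neg]
      exact integral_congr_ae (ae_restrict_of_ae_restrict_of_subset
        (Set.Ioo_subset_Ioo_right hy.2) (hsmul _))
    rw [h1, intervalIntegral.integral_neg, intervalIntegral.integral_eq_sub_of_hasDerivAt
      (fun z _ => hcos z) (Continuous.intervalIntegrable (by fun_prop) _ _)]
    ring

theorem isNegLaplacian_finset_sum (s : Finset ℕ+) (c : ℕ+ → ℝ) :
    IsNegLaplacian (∑ p ∈ s, c p • eigenfun p) (∑ p ∈ s, (eigenvalue p * c p) • eigenfun p) := by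
  induction s using Finset.induction_on with
  | empty => simpa using IsNegLaplacian.zero
  | insert p s hp ih =>
    rw [Finset.sum_insert hp, Finset.sum_insert hp]
    exact (isNegLaplacian_smul_eigenfun (c p) p).add ih

/-! ### The kernel bound and the source term -/

theorem one_le_eigenvalue (p : ℕ+) : 1 ≤ eigenvalue p := by
  have : (1 : ℝ) ≤ ((p : ℕ) : ℝ) := by exact_mod_cast p.pos
  exact one_le_pow₀ this

theorem eigenvalue_rpow_mul_rpow {β t : ℝ} (hβ : 0 < β) (p : ℕ+) (ht : 0 ≤ t) :
    eigenvalue p * t ^ β = (eigenvalue p ^ (1 / β) * t) ^ β := by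
  rw [Real.mul_rpow (Real.rpow_nonneg (eigenvalue_pos p).le _) ht,
    ← Real.rpow_mul (eigenvalue_pos p).le, one_div, inv_mul_cancel₀ hβ.ne', Real.rpow_one]

theorem exists_isKernelBound {β : ℝ} (hβ : 1 < β) (a : ℝ) : ∃ C₃ : ℝ, IsKernelBound β a C₃ := by
  refine ⟨54, by norm_num, fun t ht p => ?_⟩
  rcases ht.1.eq_or_lt with rfl | ht0
  · rw [Real.zero_rpow (by linarith), zero_mul]; positivity
  have h1 : 1 ≤ eigenvalue p ^ (1 / β) :=
    Real.one_le_rpow (one_le_eigenvalue p) (by positivity)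
  have hs : 0 < eigenvalue p ^ (1 / β) * t := by positivity
  rw [eigenvalue_rpow_mul_rpow (by linarith) p ht0.le]
  refine le_trans (mul_le_mul_of_nonneg_right ?_ ?_) (rpow_mul_mittagLeffler_self_le hβ hs)
  · exact Real.rpow_le_rpow ht0.le (le_mul_of_one_le_left ht0.le h1) (by linarith)
  · exact mittagLeffler_nonneg hβ.le hβ.le (by positivity)

/-- The coefficient of the source term on the `p`-th mode. -/
def sourceWeight (β a C₃ : ℝ) (p : ℕ+) (t : ℝ) : ℝ :=
  Real.exp (eigenvalue p ^ (1 / β) * (t - a)) / (2 * a * C₃)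

theorem continuous_sourceWeight (β a C₃ : ℝ) (p : ℕ+) : Continuous (sourceWeight β a C₃ p) := by
  unfold sourceWeight; fun_prop

theorem sourceWeight_nonneg {β a C₃ : ℝ} (ha : 0 < a) (hC : 0 < C₃) (p : ℕ+) (t : ℝ) :
    0 ≤ sourceWeight β a C₃ p t := by
  unfold sourceWeight; positivity

theorem sourceWeight_le {β a C₃ : ℝ} (ha : 0 < a) (hC : 0 < C₃) (p : ℕ+) {t : ℝ} (ht : t ≤ a) :
    sourceWeight β a C₃ p t ≤ 1 / (2 * a * C₃) := by
  refine div_le_div_of_nonneg_right (Real.exp_le_one_iff.2 ?_) (by positivity)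
  exact mul_nonpos_of_nonneg_of_nonpos (Real.rpow_nonneg (eigenvalue_pos p).le _) (by linarith)

/-- The `p`-th Fourier coefficient as a continuous linear functional. -/
def coeff (p : ℕ+) : L2 →L[ℝ] ℝ := innerSL ℝ (eigenfun p)

theorem coeff_apply (p : ℕ+) (v : L2) : coeff p v = inner ℝ v (eigenfun p) := by
  rw [coeff, innerSL_apply_apply, real_inner_comm]

theorem coeff_sourceG {β a C₃ : ℝ} (ha : 0 < a) (hC : 0 < C₃) {t : ℝ} (ht : t ≤ a) (v : L2)
    (p : ℕ+) : coeff p (sourceG β a C₃ t v) = sourceWeight β a C₃ p t * coeff p v := by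
  have hs : Summable fun p => (sourceWeight β a C₃ p t * inner ℝ v (eigenfun p)) ^ 2 := by
    have h1 := (orthonormal_eigenfun.inner_products_summable (x := v)).mul_left
      ((1 / (2 * a * C₃)) ^ 2)
    refine Summable.of_nonneg_of_le (fun _ => by positivity) (fun q => ?_) h1
    rw [mul_pow, real_inner_comm, Real.norm_eq_abs, sq_abs]
    refine mul_le_mul_of_nonneg_right ?_ (by positivity)
    exact pow_le_pow_left₀ (sourceWeight_nonneg ha hC q t) (sourceWeight_le ha hC q ht) 2
  rw [coeff_apply, coeff_apply]
  exact inner_of_hasSum (summable_smul_eigenfun hs).hasSum p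

/-- The bound on the kernel makes each mode a Volterra equation with contraction constant
`1 / 2`, since the exponential growth of the kernel is cancelled by the weight. -/
theorem isHalfKernel_mode {β a C₃ : ℝ} (hβ : 1 < β) (ha : 0 < a) (hC : IsKernelBound β a C₃)
    (p : ℕ+) : IsHalfKernel a (mlKernel β (eigenvalue p)) (sourceWeight β a C₃ p) where
  continuous_kernel := continuous_mlKernel hβ.le _
  continuous_weight := continuous_sourceWeight β a C₃ p
  nonneg s t _ hst _ := mul_nonneg (mlKernel_nonneg hβ.le (eigenvalue_pos p).le (by linarith))
    (sourceWeight_nonneg ha hC.1 p s)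
  le s t hs hst hta := by
    have hC0 := hC.1
    have h1 := hC.2 (t - s) ⟨by linarith, by linarith⟩ p
    calc mlKernel β (eigenvalue p) (t - s) * sourceWeight β a C₃ p s
        ≤ C₃ * Real.exp (eigenvalue p ^ (1 / β) * (t - s)) * sourceWeight β a C₃ p s :=
          mul_le_mul_of_nonneg_right h1 (sourceWeight_nonneg ha hC.1 p s)
      _ = Real.exp (eigenvalue p ^ (1 / β) * (t - a)) / (2 * a) := by
          rw [sourceWeight, show eigenvalue p ^ (1 / β) * (t - a) =
            eigenvalue p ^ (1 / β) * (t - s) + eigenvalue p ^ (1 / β) * (s - a) by ring,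
            Real.exp_add]
          field_simp
      _ ≤ 1 / (2 * a) := by
          refine div_le_div_of_nonneg_right (Real.exp_le_one_iff.2 ?_) (by positivity)
          exact mul_nonpos_of_nonneg_of_nonpos (Real.rpow_nonneg (eigenvalue_pos p).le _)
            (by linarith)

/-! ### Solutions mode by mode -/

/-- The function `y` solves the mild equation of the `p`-th mode with initial value `c` and initial
velocity `0`. -/
def SolvesMode (β a C₃ : ℝ) (p : ℕ+) (c : ℝ) (y : ℝ → ℝ) : Prop :=
  ∀ t ∈ Set.Icc 0 a, y t = c * mittagLeffler β 1 (eigenvalue p * t ^ β) +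
    ∫ s in (0 : ℝ)..t, mlKernel β (eigenvalue p) (t - s) * (sourceWeight β a C₃ p s * y s)

theorem SolvesMode.const_mul {β a C₃ : ℝ} {p : ℕ+} {c : ℝ} {y : ℝ → ℝ}
    (h : SolvesMode β a C₃ p c y) (r : ℝ) : SolvesMode β a C₃ p (r * c) fun t => r * y t := by
  intro t ht
  simp only
  rw [h t ht, mul_add, mul_assoc, ← intervalIntegral.integral_const_mul]
  congr 1
  exact intervalIntegral.integral_congr fun s _ => by ring

theorem SolvesMode.eq {β a C₃ : ℝ} (hβ : 1 < β) (ha : 0 < a) (hC : IsKernelBound β a C₃)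
    {p : ℕ+} {c : ℝ} {y₁ y₂ : ℝ → ℝ} (h₁ : SolvesMode β a C₃ p c y₁)
    (h₂ : SolvesMode β a C₃ p c y₂) (c₁ : ContinuousOn y₁ (Set.Icc 0 a))
    (c₂ : ContinuousOn y₂ (Set.Icc 0 a)) {t : ℝ} (ht : t ∈ Set.Icc 0 a) : y₁ t = y₂ t :=
  (isHalfKernel_mode hβ ha hC p).unique ha c₁ c₂ h₁ h₂ ht

theorem SolvesMode.exp_le {β a C₃ : ℝ} (hβ : 1 < β) (hβ2 : β < 2) (ha : 0 < a)
    (hC : IsKernelBound β a C₃) {p : ℕ+} {c : ℝ} (hc : 0 ≤ c) {y : ℝ → ℝ}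
    (h : SolvesMode β a C₃ p c y) (hy : ContinuousOn y (Set.Icc 0 a)) :
    c * (1 / 108 * Real.exp (eigenvalue p ^ (1 / β) * a)) ≤ y a := by
  have h1 := (isHalfKernel_mode hβ ha hC p).free_term_le ha hy (fun t ht => mul_nonneg hc
    (mittagLeffler_nonneg hβ.le le_rfl
      (mul_nonneg (eigenvalue_pos p).le (Real.rpow_nonneg ht.1 _)))) h ⟨ha.le, le_rfl⟩
  refine le_trans (mul_le_mul_of_nonneg_left ?_ hc) h1
  rw [eigenvalue_rpow_mul_rpow (by linarith) p ha.le]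
  exact exp_le_mittagLeffler_one hβ hβ2
    (mul_pos (Real.rpow_pos_of_pos (eigenvalue_pos p) _) ha)

theorem exists_solvesMode {β a C₃ : ℝ} (hβ : 1 < β) (ha : 0 < a) (hC : IsKernelBound β a C₃)
    (p : ℕ+) (c : ℝ) : ∃ y : ℝ → ℝ, Continuous y ∧ SolvesMode β a C₃ p c y := by
  refine (isHalfKernel_mode hβ ha hC p).exists_solution ha (continuous_const.mul ?_)
  exact (continuous_mittagLeffler hβ.le le_rfl).comp
    (continuous_const.mul (Real.continuous_rpow_const (by linarith)))

theorem solvesMode_iff_eq_fracInt {β a C₃ : ℝ} (hβ : 1 < β) {p : ℕ+} {c : ℝ} {y : ℝ → ℝ}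
    (hy : ContinuousOn y (Set.Icc 0 a)) :
    SolvesMode β a C₃ p c y ↔ ∀ t ∈ Set.Icc 0 a,
      y t = c + fracInt β (fun s => (eigenvalue p + sourceWeight β a C₃ p s) * y s) t := by
  simp only [add_mul]
  exact eq_mittagLeffler_iff hβ.le (eigenvalue_pos p).le hy
    ((continuous_sourceWeight β a C₃ p).continuousOn.mul hy)

section Trajectory

variable {a : ℝ} {ha : 0 < a} {β C₃ : ℝ} {u₀ : L2} {u : CL2 a}

theorem continuous_extend (ha : 0 < a) (u : CL2 a) : Continuous (Set.IccExtend ha.le u) :=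
  u.continuous.Icc_extend'

theorem continuous_coeff_extend (ha : 0 < a) (u : CL2 a) (p : ℕ+) :
    Continuous fun t => coeff p (Set.IccExtend ha.le u t) :=
  (coeff p).continuous.comp (continuous_extend ha u)

theorem mildCoeff_integrand_eq (hC : 0 < C₃) (p : ℕ+) {t η : ℝ} (hη : η ≤ a) :
    (t - η) ^ (β - 1) * mittagLeffler β β (eigenvalue p * (t - η) ^ β) *
        inner ℝ (sourceG β a C₃ η (Set.IccExtend ha.le u η)) (eigenfun p) =
      mlKernel β (eigenvalue p) (t - η) *
        (sourceWeight β a C₃ p η * coeff p (Set.IccExtend ha.le u η)) := by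
  rw [← coeff_apply, coeff_sourceG ha hC hη, mlKernel]

theorem mildCoeff_eq (hC : 0 < C₃) (p : ℕ+) {t : ℝ} (ht : t ∈ Set.Icc 0 a) :
    mildCoeff β (sourceG β a C₃) u₀ 0 (Set.IccExtend ha.le u) t p =
      coeff p u₀ * mittagLeffler β 1 (eigenvalue p * t ^ β) +
        ∫ s in (0 : ℝ)..t, mlKernel β (eigenvalue p) (t - s) *
          (sourceWeight β a C₃ p s * coeff p (Set.IccExtend ha.le u s)) := by
  rw [mildCoeff, inner_zero_left, mul_zero, add_zero, ← coeff_apply,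
    mul_comm (mittagLeffler β 1 _)]
  congr 1
  refine intervalIntegral.integral_congr fun s hs => ?_
  rw [Set.uIcc_of_le ht.1] at hs
  exact mildCoeff_integrand_eq (ha := ha) hC p (hs.2.trans ht.2)

/-- The mild formulation with zero initial velocity decouples into the modes. -/
theorem isMildSolution_iff (hβ : 1 < β) (hC : IsKernelBound β a C₃) :
    IsMildSolution β ha (sourceG β a C₃) u₀ 0 u ↔
      ∀ p, SolvesMode β a C₃ p (coeff p u₀) fun t => coeff p (Set.IccExtend ha.le u t) := by
  constructor
  · intro h p t ht
    simp only
    rw [← mildCoeff_eq (ha := ha) hC.1 p ht, coeff_apply]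
    exact inner_of_hasSum (h.hasSum t ht) p
  · intro h
    refine ⟨fun t ht p => ?_, fun t ht => ?_⟩
    · have h1 := (isHalfKernel_mode hβ ha hC p).intervalIntegrable ht.1
        (continuous_coeff_extend ha u p).continuousOn
      refine h1.congr fun s hs => ?_
      rw [Set.uIoc_of_le ht.1] at hs
      exact (mildCoeff_integrand_eq (ha := ha) hC.1 p (hs.2.trans ht.2)).symm
    · refine (hasSum_inner_smul_eigenfun (Set.IccExtend ha.le u t)).congr_fun fun p => ?_
      have h1 := h p t ht
      beta_reduce at h1
      rw [mildCoeff_eq (ha := ha) hC.1 p ht, ← h1, coeff_apply]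

theorem IsMildSolution.eq (hβ : 1 < β) (hC : IsKernelBound β a C₃) {v : CL2 a}
    (hu : IsMildSolution β ha (sourceG β a C₃) u₀ 0 u)
    (hv : IsMildSolution β ha (sourceG β a C₃) u₀ 0 v) : u = v := by
  rw [isMildSolution_iff hβ hC] at hu hv
  ext1 t
  refine eq_of_inner_eigenfun_eq fun p => ?_
  have := (hu p).eq hβ ha hC (hv p) (continuous_coeff_extend ha u p).continuousOn
    (continuous_coeff_extend ha v p).continuousOn t.2
  simpa only [coeff_apply, Set.IccExtend_val] using this

theorem caputoDeriv_eq (β : ℝ) (U : ℝ → L2) (t : ℝ) :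
    caputoDeriv β U t = ∫ η in (0 : ℝ)..t, rlKernel (2 - β) (t - η) • deriv (deriv U) η := by
  rw [caputoDeriv, ← intervalIntegral.integral_smul]
  refine intervalIntegral.integral_congr fun η _ => ?_
  simp only [rlKernel, smul_smul]
  rw [show 2 - β - 1 = 1 - β by ring]
  congr 1
  ring

theorem coeff_caputoDeriv {β : ℝ} {U : ℝ → L2} {t : ℝ}
    (hi : IntervalIntegrable (fun η => (t - η) ^ (1 - β) • deriv (deriv U) η) volume 0 t)
    (p : ℕ+) : coeff p (caputoDeriv β U t) =
      fracInt (2 - β) (fun η => coeff p (deriv (deriv U) η)) t := by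
  have hi' : IntervalIntegrable (fun η => rlKernel (2 - β) (t - η) • deriv (deriv U) η)
      volume 0 t := by
    refine (hi.smul (1 / Real.Gamma (2 - β))).congr fun η _ => ?_
    simp only [rlKernel, Pi.smul_apply, smul_smul]
    rw [show 2 - β - 1 = 1 - β by ring]
    congr 1
    ring
  rw [caputoDeriv_eq, ← (coeff p).intervalIntegral_comp_comm hi', fracInt]
  simp only [map_smul, smul_eq_mul]

/-- A strong solution is a mild solution: its Fourier coefficients solve scalar Caputo
equations. -/
theorem IsStrongSolution.isMildSolution (hβ : 1 < β) (hβ2 : β < 2) (hC : IsKernelBound β a C₃)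
    (h : IsStrongSolution β ha (sourceG β a C₃) u₀ 0 u) :
    IsMildSolution β ha (sourceG β a C₃) u₀ 0 u := by
  rw [isMildSolution_iff hβ hC]
  intro p
  set U := Set.IccExtend ha.le u with hU
  have hud : UniqueDiffOn ℝ (Set.Icc 0 a) := uniqueDiffOn_Icc ha
  obtain ⟨hd, hdc⟩ := (contDiffOn_one_iff_derivWithin hud).1 h.contDiffOn
  have hyc : ContinuousOn (fun t => coeff p (U t)) (Set.Icc 0 a) :=
    (continuous_coeff_extend ha u p).continuousOn
  rw [solvesMode_iff_eq_fracInt hβ hyc]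
  intro t ht
  have h0 : coeff p u₀ = coeff p (U 0) := congrArg (coeff p) h.initial.symm
  rw [h0]
  refine eq_fracInt_of_caputo hβ hβ2 (y := fun t => coeff p (U t))
    (y₁ := fun t => coeff p (derivWithin U (Set.Icc 0 a) t))
    (y₂ := fun t => coeff p (deriv (deriv U) t)) (fun s hs => ?_) ?_ ?_ (fun s hs => ?_) ?_ ?_
    (fun s hs => ?_) ht
  · exact (coeff p).hasFDerivAt.comp_hasDerivWithinAt s (hd s hs).hasDerivWithinAt
  · exact (coeff p).continuous.comp_continuousOn hdc
  · rw [h.initial_velocity.derivWithin (hud 0 ⟨le_rfl, ha.le⟩), map_zero]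
  · have e : derivWithin U (Set.Icc 0 a) =ᶠ[𝓝 s] deriv U := by
      filter_upwards [Ioo_mem_nhds hs.1 hs.2] with x hx
      exact derivWithin_of_mem_nhds (Icc_mem_nhds hx.1 hx.2)
    exact (coeff p).hasFDerivAt.comp_hasDerivAt s
      ((h.differentiableAt_deriv s hs).hasDerivAt.congr_of_eventuallyEq e)
  · exact ⟨(coeff p).integrable_comp h.integrable_deriv2.1,
      (coeff p).integrable_comp h.integrable_deriv2.2⟩
  · exact (continuous_const.add (continuous_sourceWeight β a C₃ p)).continuousOn.mul hyc
  · obtain ⟨w, hw, heq⟩ := h.equation s hs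
    rw [← coeff_caputoDeriv (h.integrable_caputo s hs), heq, map_add,
      coeff_sourceG ha hC.1 hs.2.le, coeff_apply p w, inner_eigenfun_of_isNegLaplacian hw,
      ← coeff_apply, add_mul]

end Trajectory

/-! ### Solutions with finitely many modes -/

/-- The curve `t ↦ w(t) φ_p` in `L²(0, π)`. -/
def modeCurve (a : ℝ) (p : ℕ+) (w : C(ℝ, ℝ)) : CL2 a :=
  ⟨fun t => w t • eigenfun p, by fun_prop⟩

theorem extend_sum_modeCurve {a : ℝ} (ha : 0 < a) (w : ℕ+ → C(ℝ, ℝ)) (s : Finset ℕ+) (c : ℕ+ → ℝ)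
    {t : ℝ} (ht : t ∈ Set.Icc 0 a) :
    Set.IccExtend ha.le (∑ p ∈ s, c p • modeCurve a p (w p) : CL2 a) t =
      ∑ p ∈ s, (c p * w p t) • eigenfun p := by
  rw [Set.IccExtend_of_mem ha.le _ ht, ContinuousMap.sum_apply]
  simp [modeCurve, smul_smul]

theorem coeff_sum_smul_eigenfun (s : Finset ℕ+) (c : ℕ+ → ℝ) (p : ℕ+) :
    coeff p (∑ q ∈ s, c q • eigenfun q) = if p ∈ s then c p else 0 := by
  rw [coeff_apply, inner_finset_sum_eigenfun]

theorem isMildSolution_sum {a β C₃ : ℝ} (ha : 0 < a) (hβ : 1 < β) (hC : IsKernelBound β a C₃)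
    {w : ℕ+ → C(ℝ, ℝ)} (hw : ∀ p, SolvesMode β a C₃ p 1 (w p)) (s : Finset ℕ+) (c : ℕ+ → ℝ) :
    IsMildSolution β ha (sourceG β a C₃) (∑ p ∈ s, c p • eigenfun p) 0
      (∑ p ∈ s, c p • modeCurve a p (w p)) := by
  rw [isMildSolution_iff hβ hC]
  intro p t ht
  have e : ∀ t ∈ Set.Icc 0 a, coeff p (Set.IccExtend ha.le
      (∑ p ∈ s, c p • modeCurve a p (w p) : CL2 a) t) = (if p ∈ s then c p else 0) * w p t :=
    fun t ht => by
      rw [extend_sum_modeCurve ha w s c ht, coeff_sum_smul_eigenfun s fun q => c q * w q t]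
      split_ifs <;> simp
  have h := (hw p).const_mul (if p ∈ s then c p else 0) t ht
  rw [mul_one] at h
  beta_reduce at h ⊢
  rw [e t ht, h, coeff_sum_smul_eigenfun]
  congr 1
  refine intervalIntegral.integral_congr fun x hx => ?_
  rw [Set.uIcc_of_le ht.1] at hx
  simp only [e x ⟨hx.1, hx.2.trans ht.2⟩]

theorem hasDerivAt_sourceWeight (β a C₃ : ℝ) (p : ℕ+) (t : ℝ) :
    HasDerivAt (sourceWeight β a C₃ p) (eigenvalue p ^ (1 / β) * sourceWeight β a C₃ p t) t := by
  have h := ((((hasDerivAt_id t).sub_const a).const_mul (eigenvalue p ^ (1 / β))).exp).div_const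
    (2 * a * C₃)
  refine h.congr_deriv ?_
  simp only [id, mul_one, sourceWeight]
  ring

theorem isStrongSolution_sum {a β C₃ : ℝ} (ha : 0 < a) (hβ : 1 < β) (hβ2 : β < 2)
    (hC : IsKernelBound β a C₃) {w : ℕ+ → C(ℝ, ℝ)} (hw : ∀ p, SolvesMode β a C₃ p 1 (w p))
    (s : Finset ℕ+) (c : ℕ+ → ℝ) :
    IsStrongSolution β ha (sourceG β a C₃) (∑ p ∈ s, c p • eigenfun p) 0
      (∑ p ∈ s, c p • modeCurve a p (w p)) := by
  set u : CL2 a := ∑ p ∈ s, c p • modeCurve a p (w p) with hu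
  set U := Set.IccExtend ha.le u with hU
  have hUe : ∀ t ∈ Set.Icc 0 a, U t = ∑ p ∈ s, (c p * w p t) • eigenfun p := fun t ht =>
    extend_sum_modeCurve ha w s c ht
  have key := fun p => exists_deriv_of_eq_fracInt hβ hβ2 ha.le
    (q := fun t => eigenvalue p + sourceWeight β a C₃ p t)
    (q' := fun t => eigenvalue p ^ (1 / β) * sourceWeight β a C₃ p t)
    (w p).continuous.continuousOn
    (fun t => (hasDerivAt_sourceWeight β a C₃ p t).const_add (eigenvalue p))
    (continuous_const.mul (continuous_sourceWeight β a C₃ p))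
    ((solvesMode_iff_eq_fracInt hβ (w p).continuous.continuousOn).1 (hw p))
  choose w₁ w₂ hd hc₁ h0 hd₂ hi₂ hcap using key
  set U₁ : ℝ → L2 := fun t => ∑ p ∈ s, (c p * w₁ p t) • eigenfun p with hU₁
  set U₂ : ℝ → L2 := fun t => ∑ p ∈ s, (c p * w₂ p t) • eigenfun p with hU₂
  have hud : UniqueDiffOn ℝ (Set.Icc 0 a) := uniqueDiffOn_Icc ha
  have hUd : ∀ t ∈ Set.Icc 0 a, HasDerivWithinAt U (U₁ t) (Set.Icc 0 a) t := fun t ht => by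
    have : HasDerivWithinAt (fun t => ∑ p ∈ s, (c p * w p t) • eigenfun p) (U₁ t)
        (Set.Icc 0 a) t :=
      HasDerivWithinAt.fun_sum fun p _ => ((hd p t ht).const_mul (c p)).smul_const (eigenfun p)
    exact this.congr_of_mem hUe ht
  have hUdw : ∀ t ∈ Set.Icc 0 a, derivWithin U (Set.Icc 0 a) t = U₁ t := fun t ht =>
    (hUd t ht).derivWithin (hud t ht)
  have hderiv : ∀ t ∈ Set.Ioo 0 a, deriv U =ᶠ[𝓝 t] U₁ := fun t ht => by
    filter_upwards [Ioo_mem_nhds ht.1 ht.2] with x hx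
    exact ((hUd x ⟨hx.1.le, hx.2.le⟩).hasDerivAt (Icc_mem_nhds hx.1 hx.2)).deriv
  have hUd₂ : ∀ t ∈ Set.Ioo 0 a, HasDerivAt (deriv U) (U₂ t) t := fun t ht => by
    have : HasDerivAt U₁ (U₂ t) t :=
      HasDerivAt.fun_sum fun p _ => ((hd₂ p t ht).const_mul (c p)).smul_const (eigenfun p)
    exact this.congr_of_eventuallyEq (hderiv t ht)
  have hU₁c : ContinuousOn U₁ (Set.Icc 0 a) :=
    continuousOn_finsetSum _ fun p _ => (continuousOn_const.mul (hc₁ p)).smul continuousOn_const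
  have hsmul : ∀ {f : ℝ → ℝ} {t : ℝ} (p : ℕ+), IntervalIntegrable f volume 0 t →
      IntervalIntegrable (fun x => f x • eigenfun p) volume 0 t := fun p h =>
    ⟨h.1.smul_const _, h.2.smul_const _⟩
  have hsum : ∀ {f : ℕ+ → ℝ → ℝ} {t : ℝ}, (∀ p, IntervalIntegrable (f p) volume 0 t) →
      IntervalIntegrable (fun x => ∑ p ∈ s, f p x • eigenfun p) volume 0 t := fun {f t} h => by
    have := IntervalIntegrable.sum s (f := fun p x => f p x • eigenfun p) fun p _ => hsmul p (h p)
    simpa only [Finset.sum_fn] using this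
  have hcapInt : ∀ t ∈ Set.Ioo 0 a,
      IntervalIntegrable (fun η => (t - η) ^ (1 - β) • deriv (deriv U) η) volume 0 t := by
    intro t ht
    have h1 : IntervalIntegrable (fun η => ∑ p ∈ s, (Real.Gamma (2 - β) * c p *
        (rlKernel (2 - β) (t - η) * w₂ p η)) • eigenfun p) volume 0 t :=
      hsum fun p => (hcap p t ht).1.const_mul _
    refine h1.congr_uIoo fun η hη => ?_
    rw [Set.uIoo_of_le ht.1.le] at hη
    have hG : Real.Gamma (2 - β) ≠ 0 := (Real.Gamma_pos_of_pos (by linarith)).ne'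
    simp only [(hUd₂ η ⟨hη.1, hη.2.trans ht.2⟩).deriv, hU₂, Finset.smul_sum, smul_smul, rlKernel]
    refine Finset.sum_congr rfl fun p _ => ?_
    rw [show 2 - β - 1 = 1 - β by ring]
    congr 1
    field_simp
  refine ⟨?_, fun t ht => (hUd₂ t ht).differentiableAt, ?_, ?_, ?_, hcapInt, fun t ht => ?_⟩
  · rw [contDiffOn_one_iff_derivWithin hud]
    exact ⟨fun t ht => (hUd t ht).differentiableWithinAt, hU₁c.congr hUdw⟩
  · refine (hsum fun p => (hi₂ p).const_mul (c p)).congr_uIoo fun t ht => ?_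
    rw [Set.uIoo_of_le ha.le] at ht
    exact (hUd₂ t ht).deriv.symm
  · change U 0 = _
    rw [hUe 0 ⟨le_rfl, ha.le⟩]
    refine Finset.sum_congr rfl fun p _ => ?_
    have := hw p 0 ⟨le_rfl, ha.le⟩
    rw [intervalIntegral.integral_same, add_zero, Real.zero_rpow (by linarith), mul_zero,
      one_mul] at this
    have h1 := mittagLeffler_one_eq hβ.le le_rfl (le_refl (0 : ℝ))
    rw [zero_mul, zero_mul, add_zero] at h1
    rw [this, h1, mul_one]
  · have := hUd 0 ⟨le_rfl, ha.le⟩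
    simpa [hU₁, h0] using this
  · refine ⟨∑ p ∈ s, (eigenvalue p * (c p * w p t)) • eigenfun p, ?_, ?_⟩
    · change IsNegLaplacian (U t) _
      rw [hUe t ⟨ht.1.le, ht.2.le⟩]
      exact isNegLaplacian_finset_sum s fun p => c p * w p t
    · change caputoDeriv β U t = _ + sourceG β a C₃ t (U t)
      refine eq_of_inner_eigenfun_eq fun p => ?_
      rw [← coeff_apply, ← coeff_apply, coeff_caputoDeriv (hcapInt t ht), map_add,
        coeff_sourceG ha hC.1 ht.2.le, hUe t ⟨ht.1.le, ht.2.le⟩,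
        coeff_sum_smul_eigenfun s fun q => c q * w q t,
        coeff_sum_smul_eigenfun s fun q => eigenvalue q * (c q * w q t)]
      have e : fracInt (2 - β) (fun η => coeff p (deriv (deriv U) η)) t =
          fracInt (2 - β) (fun η => (if p ∈ s then c p else 0) * w₂ p η) t := by
        refine fracInt_congr_Ioo ht.1.le fun η hη => ?_
        rw [(hUd₂ η ⟨hη.1, hη.2.trans ht.2⟩).deriv, hU₂,
          coeff_sum_smul_eigenfun s fun q => c q * w₂ q η]
        split_ifs <;> simp
      rw [e, fracInt_const_mul, (hcap p t ht).2]
      split_ifs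
      · ring
      · simp

/-! ### Ill-posedness -/

theorem natCast_le_eigenvalue_rpow {β : ℝ} (hβ : 0 < β) (hβ2 : β ≤ 2) (p : ℕ+) :
    ((p : ℕ) : ℝ) ≤ eigenvalue p ^ (1 / β) := by
  have h1 : (1 : ℝ) ≤ ((p : ℕ) : ℝ) := by exact_mod_cast p.pos
  rw [eigenvalue, ← Real.rpow_natCast, ← Real.rpow_mul (by linarith)]
  have h2 : 1 ≤ ((2 : ℕ) : ℝ) * (1 / β) := by
    rw [mul_one_div, le_div_iff₀ hβ]; push_cast; linarith
  simpa using Real.rpow_le_rpow_of_exponent_le h1 h2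

/-- The amplification of the `p`-th mode outgrows any power of `p`; here, with the data `1 / p`. -/
theorem mul_natCast_le_exp {β a : ℝ} (hβ : 0 < β) (hβ2 : β ≤ 2) (ha : 0 < a) (p : ℕ+) :
    a ^ 2 / 216 * ((p : ℕ) : ℝ) ≤
      1 / ((p : ℕ) : ℝ) * (1 / 108 * Real.exp (eigenvalue p ^ (1 / β) * a)) := by
  have h1 : (0 : ℝ) < ((p : ℕ) : ℝ) := by exact_mod_cast p.pos
  have h2 := natCast_le_eigenvalue_rpow hβ hβ2 p
  have h3 := Real.quadratic_le_exp_of_nonneg (x := ((p : ℕ) : ℝ) * a) (by positivity)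
  have h4 : Real.exp (((p : ℕ) : ℝ) * a) ≤ Real.exp (eigenvalue p ^ (1 / β) * a) :=
    Real.exp_le_exp.2 (mul_le_mul_of_nonneg_right h2 ha.le)
  have h5 : (((p : ℕ) : ℝ) * a) ^ 2 / 2 ≤ Real.exp (eigenvalue p ^ (1 / β) * a) := by
    have : 0 ≤ ((p : ℕ) : ℝ) * a := by positivity
    linarith
  calc a ^ 2 / 216 * ((p : ℕ) : ℝ)
      = 1 / ((p : ℕ) : ℝ) * (1 / 108 * ((((p : ℕ) : ℝ) * a) ^ 2 / 2)) := by field_simp; norm_num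
    _ ≤ _ := by gcongr

theorem abs_coeff_le_norm {a : ℝ} (ha : 0 < a) (u : CL2 a) (p : ℕ+) :
    |coeff p (Set.IccExtend ha.le u a)| ≤ ‖u‖ := by
  rw [coeff_apply, Set.IccExtend_of_mem ha.le _ ⟨ha.le, le_rfl⟩]
  exact (abs_inner_eigenfun_le _ p).trans (u.norm_coe_le_norm _)

theorem summable_one_div_pnat_sq : Summable fun p : ℕ+ => (1 / ((p : ℕ) : ℝ)) ^ 2 := by
  have h : Summable fun n : ℕ => (1 / (n : ℝ)) ^ 2 := by
    simpa only [one_div, inv_pow] using Real.summable_nat_pow_inv.2 one_lt_two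
  exact h.comp_injective PNat.coe_injective

/-- Ill-posedness for any notion of solution between the finite mode solutions and the mild
solutions. -/
theorem hadamardIllPosed {a β C₃ : ℝ} (ha : 0 < a) (hβ : 1 < β) (hβ2 : β < 2)
    (hC : IsKernelBound β a C₃) {w : ℕ+ → C(ℝ, ℝ)} {Sol : L2 → L2 → CL2 a → Prop}
    (hmild : ∀ u₀ u, Sol u₀ 0 u → IsMildSolution β ha (sourceG β a C₃) u₀ 0 u)
    (hsum : ∀ (s : Finset ℕ+) (c : ℕ+ → ℝ),
      Sol (∑ p ∈ s, c p • eigenfun p) 0 (∑ p ∈ s, c p • modeCurve a p (w p))) :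
    HadamardIllPosed Sol := by
  -- a solution with `p`-th initial coefficient `1 / p` has norm at least `a² p / 216`
  have lower : ∀ (u₀ : L2) (u : CL2 a) (p : ℕ+), Sol u₀ 0 u → coeff p u₀ = 1 / ((p : ℕ) : ℝ) →
      a ^ 2 / 216 * ((p : ℕ) : ℝ) ≤ ‖u‖ := fun u₀ u p hu hp => by
    have h1 := (isMildSolution_iff hβ hC).1 (hmild u₀ u hu) p
    rw [hp] at h1
    have h2 := h1.exp_le hβ hβ2 ha hC (by positivity)
      (continuous_coeff_extend ha u p).continuousOn
    exact (mul_natCast_le_exp (by linarith) hβ2.le ha p).trans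
      (h2.trans ((le_abs_self _).trans (abs_coeff_le_norm ha u p)))
  have htop : Tendsto (fun n : ℕ => a ^ 2 / 216 * ((n.succPNat : ℕ) : ℝ)) atTop atTop := by
    refine Tendsto.const_mul_atTop (by positivity) ?_
    simp only [Nat.succPNat_coe]
    exact tendsto_natCast_atTop_atTop.comp (tendsto_add_atTop_nat 1)
  refine ⟨?_, ?_⟩
  · have hs := (summable_smul_eigenfun summable_one_div_pnat_sq).hasSum
    refine ⟨∑' p : ℕ+, (1 / ((p : ℕ) : ℝ)) • eigenfun p, 0, fun u hu => ?_⟩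
    obtain ⟨n, hn⟩ := (htop.eventually (eventually_gt_atTop ‖u‖)).exists
    exact absurd (lower _ u n.succPNat hu (by rw [coeff_apply, inner_of_hasSum hs])) hn.not_ge
  · set v : ℕ → CL2 a := fun n => ∑ p ∈ {n.succPNat}, (1 / ((p : ℕ) : ℝ)) • modeCurve a p (w p)
      with hv
    set d : ℕ → L2 := fun n => ∑ p ∈ {n.succPNat}, (1 / ((p : ℕ) : ℝ)) • eigenfun p with hd
    have hsol : ∀ n, Sol (d n) 0 (v n) := fun n => hsum {n.succPNat} fun p => 1 / ((p : ℕ) : ℝ)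
    refine ⟨0, 0, 0, d, fun _ => 0, v, by simpa using hsum ∅ 0, hsol, ?_, tendsto_const_nhds, ?_⟩
    · rw [tendsto_zero_iff_norm_tendsto_zero]
      have : ∀ n, ‖d n‖ = 1 / ((n : ℝ) + 1) := fun n => by
        rw [hd]
        simp only [Finset.sum_singleton]
        rw [norm_smul, orthonormal_eigenfun.1, mul_one, Real.norm_of_nonneg (by positivity)]
        simp
      simp only [this]
      exact tendsto_one_div_add_atTop_nhds_zero_nat
    · intro hlim
      refine not_tendsto_nhds_of_tendsto_atTop (tendsto_atTop_mono (fun n => ?_) htop) _ hlim.norm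
      refine lower _ _ _ (hsol n) ?_
      rw [hd, coeff_sum_smul_eigenfun _ fun p => 1 / ((p : ℕ) : ℝ),
        if_pos (Finset.mem_singleton_self _)]

/-! ### White noise data -/

section Noise

variable {Ω : Type*} [MeasurableSpace Ω] {P : Measure Ω} {ξ : L2 → Ω → ℝ}

theorem IsWhiteNoise.memLp (hξ : IsWhiteNoise P ξ) (f : L2) : MemLp (ξ f) 2 P := by
  have h := memLp_id_gaussianReal (μ := 0) (v := ‖f‖₊ ^ 2) 2
  rw [← (hξ.law f).map_eq] at h
  exact (memLp_map_measure_iff h.1 (hξ.law f).aemeasurable).1 h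

theorem IsWhiteNoise.integral_sq (hξ : IsWhiteNoise P ξ) (p : ℕ+) :
    ∫ ω, ξ (eigenfun p) ω ^ 2 ∂P = 1 := by
  have h := hξ.law (eigenfun p)
  have h0 : ∫ ω, ξ (eigenfun p) ω ∂P = 0 := by
    rw [h.integral_eq]; exact integral_id_gaussianReal
  have h1 := h.variance_eq
  rw [variance_of_integral_eq_zero h.aemeasurable h0, variance_id_gaussianReal] at h1
  have h2 : ‖eigenfun p‖₊ = 1 := NNReal.eq (orthonormal_eigenfun.1 p)
  simpa [h2] using h1

/-- A finite random combination of fixed vectors with white noise coefficients is square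
integrable. -/
theorem IsWhiteNoise.memLp_sum (hξ : IsWhiteNoise P ξ) {E : Type*} [NormedAddCommGroup E]
    [NormedSpace ℝ E] (s : Finset ℕ+) (ε : ℝ) (x : ℕ+ → E) :
    MemLp (fun ω => ∑ p ∈ s, (ε * ξ (eigenfun p) ω) • x p) 2 P := by
  refine memLp_finsetSum s fun p _ => ?_
  exact (ContinuousLinearMap.toSpanSingleton ℝ (x p)).comp_memLp'
    ((hξ.memLp (eigenfun p)).const_mul ε)

theorem IsWhiteNoise.integral_norm_noisyData_sq (hξ : IsWhiteNoise P ξ) (β a ε : ℝ) :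
    ∫ ω, ‖noisyData ξ β a ε ω‖ ^ 2 ∂P = ε ^ 2 * ((truncLevel β a ε : ℕ) : ℝ) := by
  have h : ∀ ω, ‖noisyData ξ β a ε ω‖ ^ 2 =
      ∑ p ∈ Finset.Icc 1 (truncLevel β a ε), ε ^ 2 * ξ (eigenfun p) ω ^ 2 := fun ω => by
    rw [noisyData, norm_sq_finset_sum_eigenfun _ fun p => ε * ξ (eigenfun p) ω]
    simp only [mul_pow]
  simp only [h]
  rw [integral_finsetSum _ fun p _ => ((hξ.memLp (eigenfun p)).integrable_sq.const_mul _)]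
  simp only [integral_const_mul, hξ.integral_sq, mul_one, Finset.sum_const, nsmul_eq_mul]
  rw [PNat.card_Icc]
  simp [mul_comm]

end Noise

theorem natCast_truncLevel (β a ε : ℝ) : ((truncLevel β a ε : ℕ) : ℝ) =
    (⌊(2 / a * Real.log (1 / ε)) ^ (β / 2)⌋₊ : ℝ) + 1 := by
  simp [truncLevel]

theorem truncLevel_le {β a ε : ℝ} (hβ : 0 < β) (hβ2 : β ≤ 2) (ha : 0 < a)
    (hε : ε ∈ Set.Ioo (0 : ℝ) 1) : ((truncLevel β a ε : ℕ) : ℝ) ≤ 2 + 2 / a * (1 / ε) := by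
  have hε0 := hε.1
  have h1 : 1 ≤ 1 / ε := by rw [le_div_iff₀ hε0]; linarith [hε.2]
  have hlog : 0 ≤ Real.log (1 / ε) := Real.log_nonneg h1
  have hlog' : Real.log (1 / ε) ≤ 1 / ε := by
    have := Real.log_le_sub_one_of_pos (show 0 < 1 / ε by positivity)
    linarith
  set x := 2 / a * Real.log (1 / ε) with hx
  have hx0 : 0 ≤ x := by positivity
  have hxr : x ^ (β / 2) ≤ 1 + x := by
    calc x ^ (β / 2) ≤ (1 + x) ^ (β / 2) := Real.rpow_le_rpow hx0 (by linarith) (by positivity)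
      _ ≤ (1 + x) ^ (1 : ℝ) := Real.rpow_le_rpow_of_exponent_le (by linarith) (by linarith)
      _ = 1 + x := Real.rpow_one _
  have hf := Nat.floor_le (Real.rpow_nonneg hx0 (β / 2))
  have hxe : x ≤ 2 / a * (1 / ε) := mul_le_mul_of_nonneg_left hlog' (by positivity)
  rw [natCast_truncLevel]
  linarith

theorem tendsto_sq_mul_truncLevel {β a : ℝ} (hβ : 0 < β) (hβ2 : β ≤ 2) (ha : 0 < a) :
    Tendsto (fun ε : ℝ => ε ^ 2 * ((truncLevel β a ε : ℕ) : ℝ)) (𝓝[>] 0) (𝓝 0) := by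
  have hlim : Tendsto (fun ε : ℝ => 2 * ε ^ 2 + 2 / a * ε) (𝓝[>] 0) (𝓝 0) := by
    have : Continuous fun ε : ℝ => 2 * ε ^ 2 + 2 / a * ε := by fun_prop
    simpa using (this.tendsto 0).mono_left nhdsWithin_le_nhds
  refine tendsto_of_tendsto_of_tendsto_of_le_of_le' tendsto_const_nhds hlim
    (Eventually.of_forall fun ε => by positivity) ?_
  filter_upwards [Ioo_mem_nhdsGT (zero_lt_one (α := ℝ))] with ε hε
  have h0 := hε.1
  calc ε ^ 2 * ((truncLevel β a ε : ℕ) : ℝ) ≤ ε ^ 2 * (2 + 2 / a * (1 / ε)) :=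
        mul_le_mul_of_nonneg_left (truncLevel_le hβ hβ2 ha hε) (by positivity)
    _ = 2 * ε ^ 2 + 2 / a * ε := by field_simp

/-- The truncation level is chosen so that the last mode is amplified by at least `ε⁻²`. -/
theorem one_div_sq_le_exp_truncLevel {β a ε : ℝ} (hβ : 0 < β) (ha : 0 < a)
    (hε : ε ∈ Set.Ioo (0 : ℝ) 1) :
    1 / ε ^ 2 ≤ Real.exp (eigenvalue (truncLevel β a ε) ^ (1 / β) * a) := by
  have hε0 := hε.1
  have h1 : 1 ≤ 1 / ε := by rw [le_div_iff₀ hε0]; linarith [hε.2]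
  have hlog : 0 ≤ Real.log (1 / ε) := Real.log_nonneg h1
  set x := 2 / a * Real.log (1 / ε) with hx
  have hx0 : 0 ≤ x := by positivity
  set N : ℝ := ((truncLevel β a ε : ℕ) : ℝ) with hN
  have hxN : x ^ (β / 2) ≤ N := by
    rw [hN, natCast_truncLevel]
    exact (Nat.lt_floor_add_one _).le
  have h2 : x ≤ eigenvalue (truncLevel β a ε) ^ (1 / β) := by
    have h3 := Real.rpow_le_rpow (Real.rpow_nonneg hx0 _) hxN (show 0 ≤ 2 / β by positivity)
    rw [← Real.rpow_mul hx0, show β / 2 * (2 / β) = 1 by field_simp, Real.rpow_one] at h3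
    rw [eigenvalue, ← hN, ← Real.rpow_natCast, ← Real.rpow_mul (by positivity)]
    convert h3 using 2
    push_cast
    ring
  calc 1 / ε ^ 2 = Real.exp (x * a) := by
        rw [hx, show 2 / a * Real.log (1 / ε) * a = Real.log (1 / ε) * (2 : ℕ) by
          field_simp; push_cast; ring, mul_comm, Real.exp_nat_mul, Real.exp_log (by positivity)]
        simp
    _ ≤ _ := Real.exp_le_exp.2 (mul_le_mul_of_nonneg_right h2 ha.le)

/-- The lower bound comes from the last retained mode, evaluated at the final time. -/
theorem le_integral_norm_sq {Ω : Type*} [MeasurableSpace Ω] {P : Measure Ω} {ξ : L2 → Ω → ℝ}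
    (hξ : IsWhiteNoise P ξ) {a β C₃ : ℝ} (ha : 0 < a) (hβ : 1 < β) (hβ2 : β < 2)
    (hC : IsKernelBound β a C₃) {w : ℕ+ → C(ℝ, ℝ)} (hw : ∀ p, SolvesMode β a C₃ p 1 (w p))
    {ε : ℝ} (hε : ε ∈ Set.Ioo (0 : ℝ) 1) :
    1 / 108 ^ 2 / ε ^ 2 ≤ ∫ ω, ‖∑ p ∈ Finset.Icc 1 (truncLevel β a ε),
      (ε * ξ (eigenfun p) ω) • modeCurve a p (w p)‖ ^ 2 ∂P := by
  have hε0 := hε.1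
  set N := truncLevel β a ε with hN
  have h1 : 1 / 108 * (1 / ε ^ 2) ≤ w N a := by
    have h2 := (hw N).exp_le hβ hβ2 ha hC zero_le_one (w N).continuous.continuousOn
    rw [one_mul] at h2
    have h3 := one_div_sq_le_exp_truncLevel (by linarith : 0 < β) ha hε
    exact (mul_le_mul_of_nonneg_left h3 (by norm_num)).trans h2
  have h4 : ∀ ω, ε ^ 2 * w N a ^ 2 * ξ (eigenfun N) ω ^ 2 ≤ ‖∑ p ∈ Finset.Icc 1 N,
      (ε * ξ (eigenfun p) ω) • modeCurve a p (w p)‖ ^ 2 := fun ω => by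
    have h5 := abs_coeff_le_norm ha
      (∑ p ∈ Finset.Icc 1 N, (ε * ξ (eigenfun p) ω) • modeCurve a p (w p)) N
    rw [extend_sum_modeCurve ha w _ (fun p => ε * ξ (eigenfun p) ω) ⟨ha.le, le_rfl⟩,
      coeff_sum_smul_eigenfun _ fun p => ε * ξ (eigenfun p) ω * w p a,
      if_pos (Finset.mem_Icc.2 ⟨one_le, le_rfl⟩)] at h5
    have h6 := pow_le_pow_left₀ (abs_nonneg _) h5 2
    rw [sq_abs] at h6
    exact le_trans (le_of_eq (by ring)) h6
  calc 1 / 108 ^ 2 / ε ^ 2 = ε ^ 2 * (1 / 108 * (1 / ε ^ 2)) ^ 2 := by field_simp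
    _ ≤ ε ^ 2 * w N a ^ 2 := by gcongr
    _ = ∫ ω, ε ^ 2 * w N a ^ 2 * ξ (eigenfun N) ω ^ 2 ∂P := by
        rw [integral_const_mul, hξ.integral_sq, mul_one]
    _ ≤ _ := integral_mono ((hξ.memLp _).integrable_sq.const_mul _)
        ((hξ.memLp_sum _ _ _).integrable_norm_pow (by norm_num)) h4

end FracElliptic

end

theorem theorem2p1 (β : ℝ) (hβ : β ∈ Set.Ioo (1 : ℝ) 2) :
    ∃ c : ℝ, 0 < c ∧ ∀ (a : ℝ) (ha : 0 < a),
      (∃ C₃ : ℝ, FracElliptic.IsKernelBound β a C₃) ∧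
      ∀ C₃ : ℝ, FracElliptic.IsKernelBound β a C₃ →
        FracElliptic.HadamardIllPosed
          (FracElliptic.IsStrongSolution β ha (FracElliptic.sourceG β a C₃)) ∧
        FracElliptic.HadamardIllPosed
          (FracElliptic.IsMildSolution β ha (FracElliptic.sourceG β a C₃)) ∧
        ∀ {Ω : Type*} [MeasurableSpace Ω] (P : Measure Ω) [IsProbabilityMeasure P]
          (ξ : FracElliptic.L2 → Ω → ℝ), FracElliptic.IsWhiteNoise P ξ →
          (∀ ε ∈ Set.Ioo (0 : ℝ) 1,
            MemLp (FracElliptic.noisyData ξ β a ε) 2 P ∧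
            ∫ ω, ‖FracElliptic.noisyData ξ β a ε ω‖ ^ 2 ∂P
              = ε ^ 2 * ((FracElliptic.truncLevel β a ε : ℕ) : ℝ)) ∧
          Tendsto (fun ε : ℝ => ∫ ω, ‖FracElliptic.noisyData ξ β a ε ω‖ ^ 2 ∂P)
            (𝓝[>] 0) (𝓝 0) ∧
          ∃ V : ℝ → Ω → FracElliptic.CL2 a,
            (∀ ε ∈ Set.Ioo (0 : ℝ) 1,
              (∀ ω : Ω, ∀ v : FracElliptic.CL2 a,
                (FracElliptic.IsStrongSolution β ha (FracElliptic.sourceG β a C₃)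
                  (FracElliptic.noisyData ξ β a ε ω) 0 v ↔ v = V ε ω) ∧
                (FracElliptic.IsMildSolution β ha (FracElliptic.sourceG β a C₃)
                  (FracElliptic.noisyData ξ β a ε ω) 0 v ↔ v = V ε ω)) ∧
              MemLp (V ε) 2 P ∧
              c / ε ^ 2 ≤ ∫ ω, ‖V ε ω‖ ^ 2 ∂P) ∧
            Tendsto (fun ε : ℝ => ∫ ω, ‖V ε ω‖ ^ 2 ∂P) (𝓝[>] 0) atTop := by
  open FracElliptic in
  obtain ⟨hβ1, hβ2⟩ := hβ
  refine ⟨1 / 108 ^ 2, by norm_num, fun a ha => ⟨exists_isKernelBound hβ1 a, fun C₃ hC => ?_⟩⟩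
  choose y hyc hy using fun p => exists_solvesMode hβ1 ha hC p 1
  set w : ℕ+ → C(ℝ, ℝ) := fun p => ⟨y p, hyc p⟩
  have hw : ∀ p, SolvesMode β a C₃ p 1 (w p) := hy
  have hstrong := isStrongSolution_sum ha hβ1 hβ2 hC hw
  have hmild := isMildSolution_sum ha hβ1 hC hw
  refine ⟨hadamardIllPosed ha hβ1 hβ2 hC (fun _ _ h => h.isMildSolution hβ1 hβ2 hC) hstrong,
    hadamardIllPosed ha hβ1 hβ2 hC (fun _ _ h => h) hmild, fun {Ω} _ P _ ξ hξ => ?_⟩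
  refine ⟨fun ε _ => ⟨hξ.memLp_sum _ ε _, hξ.integral_norm_noisyData_sq β a ε⟩, ?_, ?_⟩
  · simp only [hξ.integral_norm_noisyData_sq]
    exact tendsto_sq_mul_truncLevel (by linarith) hβ2.le ha
  set V : ℝ → Ω → CL2 a := fun ε ω => ∑ p ∈ Finset.Icc 1 (truncLevel β a ε),
    (ε * ξ (eigenfun p) ω) • modeCurve a p (w p)
  have hVs : ∀ ε ω, IsStrongSolution β ha (sourceG β a C₃) (noisyData ξ β a ε ω) 0 (V ε ω) :=
    fun ε ω => hstrong _ fun p => ε * ξ (eigenfun p) ω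
  have hVm : ∀ ε ω, IsMildSolution β ha (sourceG β a C₃) (noisyData ξ β a ε ω) 0 (V ε ω) :=
    fun ε ω => hmild _ fun p => ε * ξ (eigenfun p) ω
  have hlow : ∀ ε ∈ Set.Ioo (0 : ℝ) 1, 1 / 108 ^ 2 / ε ^ 2 ≤ ∫ ω, ‖V ε ω‖ ^ 2 ∂P :=
    fun ε hε => le_integral_norm_sq hξ ha hβ1 hβ2 hC hw hε
  refine ⟨V, fun ε hε => ⟨fun ω v => ⟨⟨fun h => ?_, fun h => h ▸ hVs ε ω⟩,
    ⟨fun h => h.eq hβ1 hC (hVm ε ω), fun h => h ▸ hVm ε ω⟩⟩, hξ.memLp_sum _ ε _, hlow ε hε⟩, ?_⟩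
  · exact (h.isMildSolution hβ1 hβ2 hC).eq hβ1 hC (hVm ε ω)
  · refine tendsto_atTop_mono' _ ?_ (?_ : Tendsto (fun ε : ℝ => 1 / 108 ^ 2 / ε ^ 2) _ _)
    · filter_upwards [Ioo_mem_nhdsGT (zero_lt_one (α := ℝ))] with ε hε using hlow ε hε
    · simp only [div_eq_mul_inv (_ : ℝ) (_ ^ 2), ← inv_pow]
      exact Tendsto.const_mul_atTop (by norm_num)
        ((tendsto_pow_atTop two_ne_zero).comp tendsto_inv_nhdsGT_zero)
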